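/- Let $P$ be a (possibly infinite) rooted forest, that is, a poset in which the elements below any given element form a finite chain. Let $P^*$ be the set of finite words over $P$ with generalized subword order: $u\le w$ if $w$ has a subword $w(i_1)\cdots w(i_k)$ of the same length as $u$ with $u(j)\le_P w(i_j)$ for all $j$. Let $P_0$ be $P$ with a bottom element $0$ adjoined, and let $\mathrm{rk}(w)$ be the sum of the ranks in $P_0$ of the letters of $w$. An open interval $(u,w)$ is called disconnected if the topological space of its order complex is the union of two disjoint nonempty open sets. An embedding of $u$ in $w$ is a word $\eta$ over $P_0$ obtained from $u$ by inserting zeros, of the same length as $w$, with $\eta(i)\le_{P_0} w(i)$ for all $i$. The position labeling labels the edges of a maximal chain $w=v_0\to v_1\to\cdots\to v_n=u$ of $[u,w]$ from top to bottom. Each $v_k$ has a canonical embedding in $w$ (that of $v_0$ is $w$ itself): $v_{k+1}$ arises from $v_k$ by decreasing one letter to the element of $P_0$ that it covers, where, if a minimal letter $a$ of $P$ is deleted, it is taken to be the leftmost one in its maximal consecutive sequence of letters $a$ in $v_k$; the label of $v_k\to v_{k+1}$ is the position in $w$ of the letter that is decreased. Maximal chains are ordered lexicographically by their label sequences. For a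 maximal chain $C$ of $[u,w]$, a skipped interval of $C$ is an open interval $I$ of $C$ such that $C\setminus I\subseteq B$ for some maximal chain $B$ of $[u,w]$ that precedes $C$; it is a minimal skipped interval (MSI) if it does not properly contain another skipped interval of $C$. **Theorem.** Let $u,w\in P^*$ with $\mathrm{rk}(w)-\mathrm{rk}(u)\ge 3$. The following are equivalent: 1. the open interval $(u,w)$ of $P^*$ is disconnected; 2. $u=(v_1,a,v_2)$ and $w=(v_1,a,a,v_2)$ for some letter $a\in P$ and some $v_1,v_2\in P^*$; 3. there is an embedding $\eta$ of $u$ in $w$ such that, for some $i$, $\eta(i)=0$, $w(i-1)=w(i)$, and $w(j)=\eta(j)$ for all $j\ne i$; 4. under the position labeling, some maximal chain of $[u,w]$ has an MSI with the maximal possible number of elements, namely $\mathrm{rk}(w)-\mathrm{rk}(u)-1$. Moreover, call a permutation layered if all components of its finest direct sum decomposition (its layers) are decreasing. Let $\sigma,\tau$ be layered permutations with $|\tau|-|\sigma|\ge 3$. Then the open interval $(\sigma,\tau)$ in the poset of all permutations ordered by pattern containment is disconnected if and only if the sequence of layer sizes of $\sigma$ is obtained from that of $\tau$ by deleting a layer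 size that is at least $3$ and equal to the one immediately preceding it. -/

import Mathlib

/-! ### Order complexes and disconnected open intervals -/

/-- The order complex of a poset: its faces are the nonempty finite chains. -/
def orderComplex (S : Type*) [PartialOrder S] : AbstractSimplicialComplex S where
  faces := {s | s.Nonempty ∧ IsChain (· ≤ ·) (s : Set S)}
  isRelLowerSet_faces := fun _ hs =>
    ⟨hs.1, fun _ hts ht => ⟨ht, hs.2.mono (Finset.coe_subset.mpr hts)⟩⟩
  singleton_mem := fun v => ⟨Finset.singleton_nonempty v, by simp⟩

/-- The geometric realization of a simplicial complex, in barycentric coordinates. The topology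
is the one of `ι → ℝ`; it is the usual one for a finite complex, and all open intervals considered
below are finite. -/
def geometricRealization {ι : Type*} (K : AbstractSimplicialComplex ι) : Set (ι → ℝ) :=
  {x | ∃ s ∈ K.faces, (∀ i, 0 ≤ x i) ∧ (∀ i, i ∉ s → x i = 0) ∧ ∑ i ∈ s, x i = 1}

/-- The open interval `(u, w)` is disconnected: the topological space of its order complex is the
union of two disjoint nonempty relatively open sets. (An empty interval is not disconnected.) -/
def IsDisconnectedInterval {S : Type*} [PartialOrder S] (u w : S) : Prop :=
  ¬ IsPreconnected (geometricRealization (orderComplex (Set.Ioo u w)))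

/-! ### Rooted forests and generalized subword order -/

/-- A rooted forest: the elements below a given element form a finite chain. Thus the poset is a
disjoint union of trees, each with a unique bottom element, and every element of `WithBot P` other
than `⊥` covers exactly one element. The poset itself may be infinite. -/
structure IsRootedForest (P : Type*) [PartialOrder P] : Prop where
  finite_Iic : ∀ a : P, (Set.Iic a).Finite
  isChain_Iic : ∀ a : P, IsChain (· ≤ ·) (Set.Iic a)

/-- Finite words in the alphabet `P`. -/
@[ext]
structure Word (P : Type*) where
  letters : List P

namespace Word

variable {P : Type*}

/-- The number of letters of a word. -/
def length (w : Word P) : ℕ := w.letters.length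

/-- The letter in position `i` (positions are numbered from `0`). -/
def letter (w : Word P) (i : Fin w.length) : P := w.letters.get i

theorem sublistForall_antisymm [PartialOrder P] {u w : List P}
    (h₁ : List.SublistForall₂ (· ≤ ·) u w) (h₂ : List.SublistForall₂ (· ≤ ·) w u) : u = w := by
  obtain ⟨l, hl, hs⟩ := List.sublistForall₂_iff.mp h₁
  obtain ⟨m, hm, ht⟩ := List.sublistForall₂_iff.mp h₂
  have e₁ := hl.length_eq
  have e₂ := hm.length_eq
  have f₁ := hs.length_le
  have f₂ := ht.length_le
  obtain rfl := hs.eq_of_length (by omega)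
  obtain rfl := ht.eq_of_length (by omega)
  clear h₁ h₂ hs ht e₁ e₂ f₁ f₂
  induction hl with
  | nil => rfl
  | cons hab _ ih =>
    cases hm with
    | cons hba hm' => rw [le_antisymm hab hba, ih hm']

/-- Generalized subword order: `u ≤ w` if `w` has a subword of the same length as `u` whose letters
are, position by position, at least those of `u`. -/
instance [PartialOrder P] : PartialOrder (Word P) where
  le u w := List.SublistForall₂ (· ≤ ·) u.letters w.letters
  le_refl u := refl_of (List.SublistForall₂ (· ≤ ·)) u.letters
  le_trans _ _ _ h₁ h₂ := trans_of (List.SublistForall₂ (· ≤ ·)) h₁ h₂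
  le_antisymm _ _ h₁ h₂ := Word.ext (sublistForall_antisymm h₁ h₂)

/-- The rank of a letter in `P` with a bottom element adjoined, so minimal letters have rank `1`.
It is finite in a rooted forest. -/
noncomputable def letterRank [PartialOrder P] (a : P) : ℕ := (Order.height (a : WithBot P)).toNat

/-- The rank of a word: the sum of the ranks of its letters. -/
noncomputable def rank [PartialOrder P] (w : Word P) : ℕ := (w.letters.map letterRank).sum

/-- The word of nonzero letters of a sequence in `P` with a bottom element `0 = ⊥` adjoined. -/
def ofNonzero {n : ℕ} (η : Fin n → WithBot P) : Word P :=
  ⟨(List.ofFn η).filterMap fun x => (WithBot.recBotCoe none some x : Option P)⟩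

/-- `η` is an embedding of `u` in `w`: it arises from `u` by inserting zeros, it has as many
positions as `w`, and `η(i) ≤ w(i)` for all `i`. -/
def IsEmbedding [PartialOrder P] (u w : Word P) (η : Fin w.length → WithBot P) : Prop :=
  ofNonzero η = u ∧ ∀ i, η i ≤ (w.letter i : WithBot P)

/-! ### Position labeling and minimal skipped intervals -/

/-- A maximal chain of `[u, w]`, listed from `w` down to `u`. -/
def IsMaximalChain [PartialOrder P] (u w : Word P) (C : List (Word P)) : Prop :=
  C.head? = some w ∧ C.getLast? = some u ∧ C.IsChain (fun x y => y ⋖ x)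

/-- One step of the position labeling. Let `e` be an embedding of a word `v'` which covers `v`.
Then `e'` is the canonical embedding of `v`, and `p` is the label of the edge from `v'` to `v`:
the letter in position `p` is decreased to one which it covers (possibly to `0 = ⊥`), and `p` is
the leftmost position in which this can be done so as to obtain `v`. (If `v'` and `v` have the same
number of letters there is only one such position; otherwise a minimal letter `a` is deleted, and
the positions in question are those of a maximal consecutive sequence of letters `a` of `v'`.) -/
def IsLabelStep [PartialOrder P] {n : ℕ} (e : Fin n → WithBot P) (v : Word P) (p : Fin n)
    (e' : Fin n → WithBot P) : Prop :=
  (∃ x, x ⋖ e p ∧ e' = Function.update e p x) ∧ ofNonzero e' = v ∧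
    ∀ q, (∃ x, x ⋖ e q ∧ ofNonzero (Function.update e q x) = v) → p ≤ q

/-- `LabelsFrom e vs ps`: if one starts from the embedding `e` and goes down along the words `vs`,
then the successive labels of the edges are `ps`. -/
inductive LabelsFrom [PartialOrder P] {n : ℕ} :
    (Fin n → WithBot P) → List (Word P) → List (Fin n) → Prop
  | nil (e : Fin n → WithBot P) : LabelsFrom e [] []
  | cons {e e' : Fin n → WithBot P} {v : Word P} {p : Fin n} {vs : List (Word P)}
      {ps : List (Fin n)} :
      IsLabelStep e v p e' → LabelsFrom e' vs ps → LabelsFrom e (v :: vs) (p :: ps)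

/-- `ps` is the sequence of labels, from top to bottom, of a chain `C` that starts at `w`. -/
def IsPositionLabeling [PartialOrder P] (w : Word P) (C : List (Word P))
    (ps : List (Fin w.length)) : Prop :=
  LabelsFrom (fun i => (w.letter i : WithBot P)) C.tail ps

/-- The maximal chain `B` of an interval with top element `w` comes before the maximal chain `C`
in the lexicographic order given by the position labeling. -/
def ChainBefore [PartialOrder P] (w : Word P) (B C : List (Word P)) : Prop :=
  ∃ ps qs, IsPositionLabeling w B ps ∧ IsPositionLabeling w C qs ∧ List.Lex (· < ·) ps qs

/-- The open interval `C(x, y)` of a chain `C`, with `x` above `y`. -/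
def openChainInterval [PartialOrder P] (C : List (Word P)) (x y : Word P) : Set (Word P) :=
  {v | v ∈ C ∧ y < v ∧ v < x}

/-- `I` is a skipped interval of the maximal chain `C` of `[u, w]`: it is an open interval of `C`,
and `C \ I` is contained in a maximal chain that comes before `C`. -/
def IsSkippedInterval [PartialOrder P] (u w : Word P) (C : List (Word P)) (I : Set (Word P)) :
    Prop :=
  (∃ x ∈ C, ∃ y ∈ C, I = openChainInterval C x y) ∧
    ∃ B, IsMaximalChain u w B ∧ ChainBefore w B C ∧ ∀ v ∈ C, v ∉ I → v ∈ B

/-- `I` is a minimal skipped interval of the maximal chain `C` of `[u, w]`: a skipped interval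
that does not properly contain another one. -/
def IsMinimalSkippedInterval [PartialOrder P] (u w : Word P) (C : List (Word P))
    (I : Set (Word P)) : Prop :=
  IsSkippedInterval u w C I ∧ ∀ J, IsSkippedInterval u w C J → ¬ J ⊂ I

end Word

/-! ### Permutations ordered by pattern containment, and layered permutations -/

/-- Permutations of `{0, ..., size - 1}`, of arbitrary length `size`. -/
structure Permutation where
  size : ℕ
  perm : Equiv.Perm (Fin size)

namespace Permutation

/-- Pattern containment: `τ` has a subsequence whose letters are in the same relative order of size
as those of `σ`. -/
def Contained (σ τ : Permutation) : Prop :=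
  ∃ f : Fin σ.size ↪o Fin τ.size, ∀ i j, σ.perm i < σ.perm j ↔ τ.perm (f i) < τ.perm (f j)

theorem contained_antisymm {σ τ : Permutation} (h₁ : Contained σ τ) (h₂ : Contained τ σ) :
    σ = τ := by
  obtain ⟨m, p⟩ := σ
  obtain ⟨n, q⟩ := τ
  obtain ⟨f, hf⟩ := h₁
  obtain ⟨g, -⟩ := h₂
  have hmn : m ≤ n := by simpa using Fintype.card_le_of_injective f f.injective
  have hnm : n ≤ m := by simpa using Fintype.card_le_of_injective g g.injective
  obtain rfl : m = n := le_antisymm hmn hnm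
  have hid : ∀ i : Fin m, f i = i := fun i => by
    have hs : Function.Surjective f := Finite.surjective_of_injective f.injective
    have h := Subsingleton.elim (StrictMono.orderIsoOfSurjective f f.strictMono hs)
      (OrderIso.refl (Fin m))
    exact DFunLike.congr_fun h i
  simp only [hid] at hf
  have hmono : StrictMono (fun i => q (p.symm i)) := fun i j hij => by
    have := (hf (p.symm i) (p.symm j)).mp (by simpa using hij)
    exact this
  have hpq : ∀ i, q (p.symm i) = i := fun i => by
    have hs : Function.Surjective (fun i => q (p.symm i)) :=
      Finite.surjective_of_injective hmono.injective
    have h := Subsingleton.elim (StrictMono.orderIsoOfSurjective _ hmono hs)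
      (OrderIso.refl (Fin m))
    exact DFunLike.congr_fun h i
  have : p = q := Equiv.ext fun i => by simpa using (hpq (p i)).symm
  rw [this]

instance : PartialOrder Permutation where
  le := Contained
  le_refl σ := ⟨RelEmbedding.refl _, fun _ _ => Iff.rfl⟩
  le_trans _ _ _ := fun ⟨f, hf⟩ ⟨g, hg⟩ =>
    ⟨f.trans g, fun i j => (hf i j).trans (hg (f i) (f j))⟩
  le_antisymm _ _ := contained_antisymm

/-- The direct sum: `σ` on the first positions, followed by `τ` shifted up by the length of `σ`. -/
def directSum (σ τ : Permutation) : Permutation :=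
  ⟨σ.size + τ.size, finSumFinEquiv.permCongr (Equiv.Perm.sumCongr σ.perm τ.perm)⟩

/-- The permutation of length `0`. -/
def empty : Permutation := ⟨0, 1⟩

/-- A nonempty permutation which is not the direct sum of two nonempty permutations. -/
def IsIndecomposable (π : Permutation) : Prop :=
  0 < π.size ∧ ∀ α β : Permutation, π = α.directSum β → α.size = 0 ∨ β.size = 0

/-- `L` is the finest decomposition of `σ`, as the direct sum of indecomposable components. -/
def IsFinestDecomposition (σ : Permutation) (L : List Permutation) : Prop :=
  σ = L.foldr directSum empty ∧ ∀ π ∈ L, IsIndecomposable π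

/-- `σ` is a layered permutation (all components of its finest decomposition are decreasing), and
`c` is its composition, the sequence of the sizes of its layers. -/
def IsLayeredWith (σ : Permutation) (c : List ℕ) : Prop :=
  ∃ L, IsFinestDecomposition σ L ∧ (∀ π ∈ L, StrictAnti π.perm) ∧ L.map size = c

end Permutation

/-!
# Disconnected intervals in generalized subword order and in the order of layered permutations

An order complex is disconnected exactly when its poset splits into two nonempty parts without
comparabilities between them (`isDisconnectedInterval_iff`): points of a common face are joined by a
segment, and conversely the two parts give disjoint open sets of barycentric coordinates.

*A repeated letter disconnects.* Let `u = v₁ a v₂` and `w = v₁ a a v₂`, cut `w` between the two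
letters `a`, and split the open interval according to whether a word still fits when something is
decreased in the left or in the right half. A word `x > u` cannot do both: comparing the two ways
in which it is then cut into a left and a right part forces `x = u`
(`Word.eq_of_le_decreased`). Both parts are nonempty since `a` has rank at least `2`.

*A disconnected interval has a maximal MSI.* Take the lexicographically first maximal chain that
meets a part missed by the first chain of all. Any chain before it has no interior element in common
with it, so nothing smaller than its whole interior is skipped
(`Word.exists_isMinimalSkippedInterval`).

*A maximal MSI forces a repeated letter.* That no proper part of the chain is skipped means that, on
each proper segment, decreasing a letter to the left of the first label never leads to a word above
the end of the segment (`Word.not_le_update`). Applied to segments of length two this makes the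
labels weakly increasing; here the rank difference `3` is used. That the whole interior is skipped
means that `u` does fit into `w` with a letter decreased to the left of the first label `p`. The common
initial segment of `u` and `w` of length `p` is then too long for what is left of it, so that its
last letter can be embedded further right. Comparing with the segments below and above the initial
run of labels `p` shows that this letter equals the letter of `w` in position `p`, and that the
chain does nothing but delete the latter (`Word.exists_repeated_letter_of_run`).

*Layered permutations.* Patterns of a direct sum are direct sums of patterns of the summands, so the
layered permutations form a lower set isomorphic to the words of positive integers
(`Permutation.layeredEmbedding`), and the claim about permutations is the case `P = ℕ+`, where the
rank of a letter is the letter itself.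
-/

/-! ### Connectedness of order complexes -/

/-- Two points of the realization carried by a common face are joined by a segment. -/
theorem joinedIn_geometricRealization {ι : Type*} {K : AbstractSimplicialComplex ι} {s : Finset ι}
    (hs : s ∈ K.faces) {x y : ι → ℝ}
    (hx : (∀ i, 0 ≤ x i) ∧ (∀ i, i ∉ s → x i = 0) ∧ ∑ i ∈ s, x i = 1)
    (hy : (∀ i, 0 ≤ y i) ∧ (∀ i, i ∉ s → y i = 0) ∧ ∑ i ∈ s, y i = 1) :
    JoinedIn (geometricRealization K) x y := by
  apply JoinedIn.of_segment_subset
  rintro z ⟨a, b, ha, hb, hab, rfl⟩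
  refine ⟨s, hs, fun i => ?_, fun i hi => ?_, ?_⟩
  · have h₁ := mul_nonneg ha (hx.1 i)
    have h₂ := mul_nonneg hb (hy.1 i)
    simpa using add_nonneg h₁ h₂
  · simp [hx.2.1 i hi, hy.2.1 i hi]
  · simp [Finset.sum_add_distrib, ← Finset.mul_sum, hx.2.2, hy.2.2, hab]

open Classical in
/-- The combinatorial meaning of disconnectedness: the open interval is the disjoint union of two
nonempty parts with no comparabilities between them. -/
theorem isDisconnectedInterval_iff {S : Type*} [PartialOrder S] {u w : S} :
    IsDisconnectedInterval u w ↔ ∃ A : Set S, (∃ x ∈ Set.Ioo u w, x ∈ A) ∧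
      (∃ x ∈ Set.Ioo u w, x ∉ A) ∧
      ∀ x ∈ Set.Ioo u w, ∀ y ∈ Set.Ioo u w, x ≤ y → (x ∈ A ↔ y ∈ A) := by
  set K := orderComplex (Set.Ioo u w) with hK
  have vtx : ∀ (s : Finset (Set.Ioo u w)), ∀ v ∈ s,
      (∀ i, 0 ≤ (Pi.single v 1 : Set.Ioo u w → ℝ) i) ∧
      (∀ i, i ∉ s → (Pi.single v 1 : Set.Ioo u w → ℝ) i = 0) ∧
      ∑ i ∈ s, (Pi.single v 1 : Set.Ioo u w → ℝ) i = 1 := by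
    intro s v hv
    refine ⟨fun i => ?_, fun i hi => ?_, ?_⟩
    · by_cases h : i = v
      · subst h; simp
      · simp [h]
    · have : i ≠ v := fun h => hi (h ▸ hv)
      simp [this]
    · simp [hv]
  constructor
  · intro h
    by_contra hA
    apply h
    -- no separating set exists, so the vertices joined to a given one are all the vertices
    have edge : ∀ v v' : Set.Ioo u w, v ≤ v' →
        JoinedIn (geometricRealization K) (Pi.single v 1) (Pi.single v' 1) := by
      intro v v' hv
      have hf : ({v, v'} : Finset (Set.Ioo u w)) ∈ K.faces := by
        refine ⟨by simp, ?_⟩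
        intro a ha b hb _
        simp only [Finset.coe_insert, Finset.coe_singleton, Set.mem_insert_iff,
          Set.mem_singleton_iff] at ha hb
        rcases ha with rfl | rfl <;> rcases hb with rfl | rfl <;> simp [hv]
      exact joinedIn_geometricRealization hf (vtx _ v (by simp)) (vtx _ v' (by simp))
    have all : ∀ v v' : Set.Ioo u w,
        JoinedIn (geometricRealization K) (Pi.single v 1) (Pi.single v' 1) := by
      intro v v'
      by_contra hv
      apply hA
      refine ⟨{z | ∃ hz : z ∈ Set.Ioo u w,
        JoinedIn (geometricRealization K) (Pi.single v 1) (Pi.single ⟨z, hz⟩ 1)},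
        ⟨v, v.2, v.2, edge v v le_rfl⟩, ⟨v', v'.2, fun ⟨_, h⟩ => hv h⟩, ?_⟩
      intro x hx y hy hxy
      exact ⟨fun ⟨_, h⟩ => ⟨hy, h.trans (edge ⟨x, hx⟩ ⟨y, hy⟩ hxy)⟩,
        fun ⟨_, h⟩ => ⟨hx, h.trans (edge ⟨x, hx⟩ ⟨y, hy⟩ hxy).symm⟩⟩
    apply isPreconnected_of_forall_pair
    rintro x ⟨s, hs, hxs⟩ y ⟨t, ht, hyt⟩
    obtain ⟨v, hv⟩ := hs.1
    obtain ⟨v', hv'⟩ := ht.1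
    have hj : JoinedIn (geometricRealization K) x y :=
      (joinedIn_geometricRealization hs hxs (vtx s v hv)).trans
        ((all v v').trans (joinedIn_geometricRealization ht (vtx t v' hv') hyt))
    obtain ⟨γ, hγ⟩ := hj
    refine ⟨Set.range γ, ?_, ⟨0, γ.source⟩, ⟨1, γ.target⟩, isPreconnected_range γ.continuous⟩
    rintro _ ⟨r, rfl⟩
    exact hγ r
  · rintro ⟨A, ⟨x, hx, hxA⟩, ⟨y, hy, hyA⟩, hA⟩ hpre
    have hop : ∀ B : Set (Set.Ioo u w), IsOpen {z : Set.Ioo u w → ℝ | ∃ i ∈ B, 0 < z i} := by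
      intro B
      have : {z : Set.Ioo u w → ℝ | ∃ i ∈ B, 0 < z i} = ⋃ i ∈ B, {z | 0 < z i} := by
        ext; simp
      rw [this]
      exact isOpen_biUnion fun i _ => isOpen_lt continuous_const (continuous_apply i)
    have hv : ∀ v : Set.Ioo u w, (Pi.single v 1 : Set.Ioo u w → ℝ) ∈ geometricRealization K :=
      fun v => ⟨{v}, ⟨by simp, by simp⟩, vtx {v} v (by simp)⟩
    obtain ⟨z, ⟨s, hs, -, hz0, -⟩, ⟨i, hi, hiz⟩, ⟨j, hj, hjz⟩⟩ :=
      hpre _ _ (hop {v | (v : S) ∈ A}) (hop {v | (v : S) ∉ A})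
      (by
        rintro z ⟨s, hs, hz, -, hsum⟩
        obtain ⟨i, -, hi⟩ : ∃ i ∈ s, 0 < z i := by
          by_contra hcon
          push Not at hcon
          have := Finset.sum_nonpos hcon
          linarith
        by_cases h : (i : S) ∈ A
        · exact Or.inl ⟨i, h, hi⟩
        · exact Or.inr ⟨i, h, hi⟩)
      ⟨_, hv ⟨x, hx⟩, ⟨x, hx⟩, hxA, by simp⟩ ⟨_, hv ⟨y, hy⟩, ⟨y, hy⟩, hyA, by simp⟩
    have his : i ∈ s := by
      by_contra h
      exact hiz.ne' (hz0 i h)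
    have hjs : j ∈ s := by
      by_contra h
      exact hjz.ne' (hz0 j h)
    rcases hs.2.total his hjs with h | h
    · exact hj ((hA i i.2 j j.2 h).1 hi)
    · exact hj ((hA j j.2 i i.2 h).2 hi)

/-- Disconnectedness is preserved by an order embedding whose range is a lower set. -/
theorem isDisconnectedInterval_map_iff {S T : Type*} [PartialOrder S] [PartialOrder T] (f : S ↪o T)
    (hf : IsLowerSet (Set.range f)) {u w : S} :
    IsDisconnectedInterval (f u) (f w) ↔ IsDisconnectedInterval u w := by
  rw [isDisconnectedInterval_iff, isDisconnectedInterval_iff]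
  have lift : ∀ y ∈ Set.Ioo (f u) (f w), ∃ x ∈ Set.Ioo u w, f x = y := by
    rintro y hy
    obtain ⟨x, rfl⟩ := hf hy.2.le ⟨w, rfl⟩
    exact ⟨x, ⟨f.lt_iff_lt.1 hy.1, f.lt_iff_lt.1 hy.2⟩, rfl⟩
  have map : ∀ x ∈ Set.Ioo u w, f x ∈ Set.Ioo (f u) (f w) := fun x hx =>
    ⟨f.lt_iff_lt.2 hx.1, f.lt_iff_lt.2 hx.2⟩
  constructor
  · rintro ⟨A, ⟨y, hy, hyA⟩, ⟨z, hz, hzA⟩, hA⟩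
    obtain ⟨y, hy', rfl⟩ := lift y hy
    obtain ⟨z, hz', rfl⟩ := lift z hz
    exact ⟨f ⁻¹' A, ⟨y, hy', hyA⟩, ⟨z, hz', hzA⟩, fun a ha b hb hab =>
      hA _ (map a ha) _ (map b hb) (f.le_iff_le.2 hab)⟩
  · rintro ⟨A, ⟨y, hy, hyA⟩, ⟨z, hz, hzA⟩, hA⟩
    refine ⟨f '' A, ⟨f y, map y hy, y, hyA, rfl⟩, ⟨f z, map z hz, ?_⟩, ?_⟩
    · rwa [f.injective.mem_set_image]
    · intro a ha b hb hab
      obtain ⟨a, ha', rfl⟩ := lift a ha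
      obtain ⟨b, hb', rfl⟩ := lift b hb
      rw [f.injective.mem_set_image, f.injective.mem_set_image]
      exact hA a ha' b hb' (f.le_iff_le.1 hab)

namespace Word

/-! ### Generalized subword order on lists -/

section Lists

variable {P : Type*} [PartialOrder P]

theorem nil_le (l : List P) : Word.mk [] ≤ Word.mk l := List.SublistForall₂.nil

theorem mk_length_le {l m : List P} (h : Word.mk l ≤ Word.mk m) : l.length ≤ m.length := by
  obtain ⟨k, hk, hs⟩ := List.sublistForall₂_iff.mp h
  exact hk.length_eq.trans_le hs.length_le

theorem cons_le_cons_iff {a b : P} {l m : List P} :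
    Word.mk (a :: l) ≤ Word.mk (b :: m) ↔
      (a ≤ b ∧ Word.mk l ≤ Word.mk m) ∨ Word.mk (a :: l) ≤ Word.mk m := by
  constructor
  · intro h
    cases h with
    | cons h₁ h₂ => exact Or.inl ⟨h₁, h₂⟩
    | cons_right h => exact Or.inr h
  · rintro (⟨h₁, h₂⟩ | h)
    · exact List.SublistForall₂.cons h₁ h₂
    · exact List.SublistForall₂.cons_right h

theorem append_le_append {l l' m m' : List P} (h : Word.mk l ≤ Word.mk m)
    (h' : Word.mk l' ≤ Word.mk m') : Word.mk (l ++ l') ≤ Word.mk (m ++ m') := by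
  obtain ⟨k, hk, hs⟩ := List.sublistForall₂_iff.mp h
  obtain ⟨k', hk', hs'⟩ := List.sublistForall₂_iff.mp h'
  exact List.sublistForall₂_iff.mpr ⟨k ++ k', List.rel_append hk hk', hs.append hs'⟩

theorem exists_of_le_append {x y z : List P} (h : Word.mk x ≤ Word.mk (y ++ z)) :
    ∃ x₁ x₂, x = x₁ ++ x₂ ∧ Word.mk x₁ ≤ Word.mk y ∧ Word.mk x₂ ≤ Word.mk z := by
  induction y generalizing x with
  | nil => exact ⟨[], x, rfl, nil_le _, h⟩
  | cons b y ih =>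
    cases x with
    | nil => exact ⟨[], [], rfl, nil_le _, nil_le _⟩
    | cons a x =>
      rcases cons_le_cons_iff.1 h with ⟨hab, h⟩ | h
      · obtain ⟨x₁, x₂, rfl, h₁, h₂⟩ := ih h
        exact ⟨a :: x₁, x₂, rfl, cons_le_cons_iff.2 (Or.inl ⟨hab, h₁⟩), h₂⟩
      · obtain ⟨x₁, x₂, hx, h₁, h₂⟩ := ih h
        exact ⟨x₁, x₂, hx, List.SublistForall₂.cons_right h₁, h₂⟩

theorem mk_le_append_left (x l : List P) : Word.mk l ≤ Word.mk (x ++ l) :=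
  append_le_append (nil_le x) le_rfl

theorem mk_le_append_right (l x : List P) : Word.mk l ≤ Word.mk (l ++ x) := by
  simpa using append_le_append (le_refl (Word.mk l)) (nil_le x)

/-- If an initial segment `H` of a word does not fit into `H'`, which is no longer than `H`, then
its last letter has to be embedded behind `H'`. -/
theorem exists_of_append_le_append {H t H' X : List P} (h : Word.mk (H ++ t) ≤ Word.mk (H' ++ X))
    (hlen : H'.length ≤ H.length) (hH : ¬ Word.mk H ≤ Word.mk H') :
    ∃ G l, H = G ++ [l] ∧ Word.mk (l :: t) ≤ Word.mk X := by
  obtain ⟨s₁, s₂, hs, h₁, h₂⟩ := exists_of_le_append h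
  have hl := mk_length_le h₁
  rcases List.append_eq_append_iff.1 hs with ⟨r, hr, -⟩ | ⟨r, hr, hr'⟩
  · have : r = [] := by
      have := congrArg List.length hr
      simp only [List.length_append] at this
      exact List.eq_nil_of_length_eq_zero (by omega)
    subst this
    rw [List.append_nil] at hr
    exact absurd (hr ▸ h₁) hH
  · rcases List.eq_nil_or_concat r with rfl | ⟨r', l, rfl⟩
    · rw [List.append_nil] at hr
      exact absurd (hr ▸ h₁) hH
    · refine ⟨s₁ ++ r', l, by simp [hr], ?_⟩
      rw [hr'] at h₂
      refine le_trans ?_ h₂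
      simpa using mk_le_append_left r' (l :: t)

end Lists

/-! ### Words with zeros -/

section Zeros

variable {P : Type*}

/-- The list of nonzero letters of a list over `P` with a bottom element adjoined. -/
def nonzero (l : List (WithBot P)) : List P :=
  l.filterMap fun x => (WithBot.recBotCoe none some x : Option P)

@[simp] theorem nonzero_nil : nonzero ([] : List (WithBot P)) = [] := rfl

@[simp] theorem nonzero_bot_cons (l : List (WithBot P)) : nonzero (⊥ :: l) = nonzero l := rfl

@[simp] theorem nonzero_coe_cons (a : P) (l : List (WithBot P)) :
    nonzero ((a : WithBot P) :: l) = a :: nonzero l := rfl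

@[simp] theorem nonzero_append (l m : List (WithBot P)) :
    nonzero (l ++ m) = nonzero l ++ nonzero m := List.filterMap_append

@[simp] theorem nonzero_map_coe (l : List P) :
    nonzero (l.map ((↑) : P → WithBot P)) = l := by
  induction l with
  | nil => rfl
  | cons a l ih => simp [ih]

theorem ofNonzero_eq {n : ℕ} (e : Fin n → WithBot P) : ofNonzero e = ⟨nonzero (List.ofFn e)⟩ := rfl

theorem ofFn_letter (w : Word P) :
    List.ofFn (fun i => (w.letter i : WithBot P)) = w.letters.map (↑) := by
  apply List.ext_getElem
  · simp [length]
  · intro i h₁ h₂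
    simp only [List.getElem_ofFn, List.getElem_map]
    rfl

@[simp] theorem ofNonzero_letter (w : Word P) :
    ofNonzero (fun i => (w.letter i : WithBot P)) = w := by
  rw [ofNonzero_eq, ofFn_letter, nonzero_map_coe]

theorem ofFn_update {n : ℕ} (e : Fin n → WithBot P) (p : Fin n) (x : WithBot P) :
    List.ofFn (Function.update e p x) = (List.ofFn e).set p x := by
  apply List.ext_getElem
  · simp
  · intro i h₁ h₂
    simp only [List.getElem_ofFn, List.getElem_set, Function.update_apply, Fin.ext_iff]
    split_ifs <;> first | rfl | omega

theorem ofFn_update_of_eq {n : ℕ} {e : Fin n → WithBot P} {q : Fin n} {L R : List (WithBot P)}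
    {y : WithBot P} (x : WithBot P) (h : List.ofFn e = L ++ y :: R) (hL : L.length = q) :
    List.ofFn (Function.update e q x) = L ++ x :: R := by
  rw [ofFn_update, h, ← hL]
  simp

theorem apply_of_ofFn {n : ℕ} {e : Fin n → WithBot P} {q : Fin n} {L R : List (WithBot P)}
    {y : WithBot P} (h : List.ofFn e = L ++ y :: R) (hL : L.length = q) : e q = y := by
  have h₁ : (List.ofFn e)[(q : ℕ)]? = some (e q) := by simp
  rw [h, ← hL] at h₁
  simpa using h₁.symm

variable [PartialOrder P]

theorem nonzero_cons_le_cons {x y : WithBot P} {l m : List (WithBot P)} (hxy : x ≤ y)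
    (h : Word.mk (nonzero l) ≤ Word.mk (nonzero m)) :
    Word.mk (nonzero (x :: l)) ≤ Word.mk (nonzero (y :: m)) := by
  induction x with
  | bot =>
    induction y with
    | bot => exact h
    | coe b => exact List.SublistForall₂.cons_right h
  | coe a =>
    induction y with
    | bot => simp at hxy
    | coe b => exact List.SublistForall₂.cons (WithBot.coe_le_coe.1 hxy) h

theorem ofNonzero_mono {n : ℕ} {e e' : Fin n → WithBot P} (h : ∀ i, e i ≤ e' i) :
    ofNonzero e ≤ ofNonzero e' := by
  rw [ofNonzero_eq, ofNonzero_eq]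
  induction n with
  | zero => simp
  | succ n ih =>
    rw [List.ofFn_succ, List.ofFn_succ]
    exact nonzero_cons_le_cons (h 0) (ih fun i => h i.succ)

theorem exists_ofNonzero_eq_of_le {n : ℕ} {e : Fin n → WithBot P} {y : Word P}
    (h : y ≤ ofNonzero e) : ∃ e' : Fin n → WithBot P, (∀ i, e' i ≤ e i) ∧ ofNonzero e' = y := by
  induction n generalizing y with
  | zero =>
    refine ⟨e, fun i => le_rfl, le_antisymm ?_ h⟩
    rw [ofNonzero_eq]
    simpa using nil_le y.letters
  | succ n ih =>
    have tail : y ≤ ofNonzero (fun i => e (Fin.succ i)) →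
        ∃ e' : Fin (n + 1) → WithBot P, (∀ i, e' i ≤ e i) ∧ ofNonzero e' = y := by
      intro h
      obtain ⟨f, hf, rfl⟩ := ih h
      refine ⟨Fin.cons ⊥ f, fun i => ?_, ?_⟩
      · refine Fin.cases ?_ (fun i => ?_) i
        · simp
        · simpa using hf i
      · rw [ofNonzero_eq, List.ofFn_succ]
        simp [ofNonzero_eq]
    rw [ofNonzero_eq, List.ofFn_succ] at h
    cases h₀ : e 0 with
    | bot =>
      rw [h₀] at h
      exact tail h
    | coe b =>
      rw [h₀, nonzero_coe_cons] at h
      obtain ⟨y⟩ := y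
      cases h with
      | nil => exact tail (nil_le _)
      | @cons a _ l _ hab h =>
        obtain ⟨f, hf, hy⟩ := ih (y := ⟨l⟩) (e := fun i => e i.succ) h
        refine ⟨Fin.cons (a : WithBot P) f, fun i => ?_, ?_⟩
        · refine Fin.cases ?_ (fun i => ?_) i
          · simpa [h₀] using hab
          · simpa using hf i
        · rw [ofNonzero_eq] at hy ⊢
          rw [List.ofFn_succ]
          simpa using hy
      | cons_right h => exact tail h

end Zeros

/-! ### Ranks and covering relations -/

section Rank

variable {P : Type*} [PartialOrder P]

theorem finite_Iic_withBot (hP : IsRootedForest P) (x : WithBot P) : (Set.Iic x).Finite := by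
  induction x with
  | bot => simp
  | coe a =>
    refine (((hP.finite_Iic a).image ((↑) : P → WithBot P)).insert ⊥).subset ?_
    intro y hy
    induction y with
    | bot => simp
    | coe b => exact Or.inr ⟨b, WithBot.coe_le_coe.1 hy, rfl⟩

theorem le_total_withBot (hP : IsRootedForest P) {x y z : WithBot P} (hx : x ≤ z) (hy : y ≤ z) :
    x ≤ y ∨ y ≤ x := by
  induction x with
  | bot => simp
  | coe a =>
    induction y with
    | bot => simp
    | coe b =>
      induction z with
      | bot => simp at hx
      | coe c =>
        simpa using (hP.isChain_Iic c).total (WithBot.coe_le_coe.1 hx) (WithBot.coe_le_coe.1 hy)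

theorem le_of_lt_of_covBy (hP : IsRootedForest P) {x y z : WithBot P} (hx : x ⋖ z) (hy : y < z) :
    y ≤ x := by
  rcases le_total_withBot hP hy.le hx.le with h | h
  · exact h
  · rcases h.eq_or_lt with rfl | h
    · exact le_rfl
    · exact absurd hy (hx.2 h)

theorem covBy_unique (hP : IsRootedForest P) {x y z : WithBot P} (hx : x ⋖ z) (hy : y ⋖ z) :
    x = y :=
  le_antisymm (le_of_lt_of_covBy hP hy hx.lt) (le_of_lt_of_covBy hP hx hy.lt)

theorem exists_le_covBy (hP : IsRootedForest P) {y z : WithBot P} (h : y < z) :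
    ∃ x, x ⋖ z ∧ y ≤ x := by
  obtain ⟨x, hx, hmax⟩ := ((finite_Iic_withBot hP z).subset
    (fun _ hx => hx.2.le : Set.Ico y z ⊆ Set.Iic z)).exists_le_maximal
    (⟨le_rfl, h⟩ : y ∈ Set.Ico y z)
  refine ⟨x, ⟨hmax.1.2, fun t hxt htz => ?_⟩, hx⟩
  exact hxt.not_ge (hmax.2 ⟨hx.trans hxt.le, htz⟩ hxt.le)

/-- The rank of an element of `P` with a bottom element adjoined. -/
noncomputable def rk (x : WithBot P) : ℕ := (Order.height x).toNat

@[simp] theorem rk_bot : rk (⊥ : WithBot P) = 0 := by simp [rk]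

theorem height_lt_top (hP : IsRootedForest P) (x : WithBot P) : Order.height x < ⊤ := by
  have hfin := finite_Iic_withBot hP x
  have : Order.height x ≤ ((Set.Iic x).ncard : ℕ) := by
    apply Order.height_le
    rintro p rfl
    have := Set.ncard_le_ncard (s := Set.range p) (t := Set.Iic p.last) (by
      rintro _ ⟨i, rfl⟩
      exact LTSeries.monotone p (Fin.le_last i)) hfin
    rw [← Nat.card_coe_set_eq, Nat.card_range_of_injective p.strictMono.injective] at this
    simp only [Nat.card_eq_fintype_card, Fintype.card_fin] at this
    exact_mod_cast (by omega : p.length ≤ _)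
  exact this.trans_lt (ENat.natCast_lt_top _)

theorem coe_rk (hP : IsRootedForest P) (x : WithBot P) : (rk x : ℕ∞) = Order.height x :=
  ENat.natCast_toNat (height_lt_top hP x).ne

theorem rk_mono (hP : IsRootedForest P) {x y : WithBot P} (h : x ≤ y) : rk x ≤ rk y := by
  have := Order.height_mono h
  rw [← coe_rk hP, ← coe_rk hP] at this
  exact_mod_cast this

theorem rk_covBy (hP : IsRootedForest P) {x y : WithBot P} (h : x ⋖ y) : rk y = rk x + 1 := by
  apply le_antisymm
  · have : Order.height y ≤ ((rk x + 1 : ℕ) : ℕ∞) := by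
      rw [Order.height_le_coe_iff]
      intro z hz
      rw [← coe_rk hP]
      exact_mod_cast Nat.lt_succ_of_le (rk_mono hP (le_of_lt_of_covBy hP h hz))
    rw [← coe_rk hP] at this
    exact_mod_cast this
  · have := Order.height_strictMono h.lt (height_lt_top hP x)
    rw [← coe_rk hP, ← coe_rk hP] at this
    exact_mod_cast this

theorem rank_ofNonzero {n : ℕ} (e : Fin n → WithBot P) : (ofNonzero e).rank = ∑ i, rk (e i) := by
  rw [← List.sum_ofFn, ofNonzero_eq, rank, List.ofFn_comp' e rk]
  generalize List.ofFn e = l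
  induction l with
  | nil => rfl
  | cons x l ih =>
    induction x with
    | bot => simpa using ih
    | coe a =>
      simp only [nonzero_coe_cons, List.map_cons, List.sum_cons] at ih ⊢
      rw [ih]
      rfl

theorem rank_update (hP : IsRootedForest P) {n : ℕ} {e : Fin n → WithBot P} {q : Fin n}
    {x : WithBot P} (h : x ⋖ e q) :
    (ofNonzero e).rank = (ofNonzero (Function.update e q x)).rank + 1 := by
  rw [rank_ofNonzero, rank_ofNonzero, ← Finset.add_sum_erase _ _ (Finset.mem_univ q),
    ← Finset.add_sum_erase _ _ (Finset.mem_univ q), Function.update_self, rk_covBy hP h]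
  have : ∑ i ∈ Finset.univ.erase q, rk (Function.update e q x i) =
      ∑ i ∈ Finset.univ.erase q, rk (e i) :=
    Finset.sum_congr rfl fun i hi => by rw [Function.update_of_ne (Finset.ne_of_mem_erase hi)]
  omega

theorem update_le {n : ℕ} {e : Fin n → WithBot P} {q : Fin n} {x : WithBot P} (h : x ≤ e q)
    (i : Fin n) : Function.update e q x i ≤ e i := by
  by_cases hi : i = q
  · subst hi; simpa using h
  · simp [hi]

/-- Everything strictly below a word lies below a word which arises by decreasing one letter of any
given sequence with zeros that represents it. -/
theorem exists_le_update_of_lt (hP : IsRootedForest P) {n : ℕ} {e : Fin n → WithBot P} {y : Word P}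
    (h : y < ofNonzero e) :
    ∃ q x, x ⋖ e q ∧ y ≤ ofNonzero (Function.update e q x) := by
  obtain ⟨e', he, rfl⟩ := exists_ofNonzero_eq_of_le h.le
  have hne : e' ≠ e := by
    rintro rfl
    exact lt_irrefl _ h
  obtain ⟨q, hq⟩ := Function.ne_iff.1 hne
  obtain ⟨x, hx, hqx⟩ := exists_le_covBy hP ((he q).lt_of_ne hq)
  refine ⟨q, x, hx, ofNonzero_mono fun i => ?_⟩
  by_cases hi : i = q
  · subst hi; simpa using hqx
  · simpa [hi] using he i

theorem rank_strictMono (hP : IsRootedForest P) {y v : Word P} (h : y < v) : y.rank < v.rank := by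
  rw [← ofNonzero_letter v] at h ⊢
  obtain ⟨q, x, hx, hle⟩ := exists_le_update_of_lt hP h
  obtain ⟨e', he, rfl⟩ := exists_ofNonzero_eq_of_le hle
  rw [rank_update (e := fun i => (v.letter i : WithBot P)) hP hx, Nat.lt_succ_iff,
    rank_ofNonzero, rank_ofNonzero]
  exact Finset.sum_le_sum fun i _ => rk_mono hP (he i)

theorem update_covBy (hP : IsRootedForest P) {n : ℕ} {e : Fin n → WithBot P} {q : Fin n}
    {x : WithBot P} (h : x ⋖ e q) : ofNonzero (Function.update e q x) ⋖ ofNonzero e := by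
  have hr := rank_update hP h
  refine ⟨lt_of_le_of_ne (ofNonzero_mono (update_le h.le)) ?_, fun y h₁ h₂ => ?_⟩
  · intro he
    rw [he] at hr
    omega
  · have := rank_strictMono hP h₁
    have := rank_strictMono hP h₂
    omega

theorem exists_update_eq_of_covBy (hP : IsRootedForest P) {n : ℕ} {e : Fin n → WithBot P}
    {y : Word P} (h : y ⋖ ofNonzero e) :
    ∃ q x, x ⋖ e q ∧ ofNonzero (Function.update e q x) = y := by
  obtain ⟨q, x, hx, hle⟩ := exists_le_update_of_lt hP h.lt
  refine ⟨q, x, hx, ?_⟩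
  rcases hle.eq_or_lt with he | hlt
  · exact he.symm
  · exact absurd (update_covBy hP hx).lt (h.2 hlt)

theorem rank_covBy (hP : IsRootedForest P) {y v : Word P} (h : y ⋖ v) : v.rank = y.rank + 1 := by
  rw [← ofNonzero_letter v] at h ⊢
  obtain ⟨q, x, hx, rfl⟩ := exists_update_eq_of_covBy hP h
  exact rank_update hP hx

end Rank

/-! ### Saturated chains and their position labels -/

section Chains

variable {P : Type*} [PartialOrder P]

/-- `DownTo v vs u`: the words `vs`, each covered by its predecessor, lead from `v` (which is not
listed) down to `u`. -/
inductive DownTo : Word P → List (Word P) → Word P → Prop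
  | nil (v : Word P) : DownTo v [] v
  | cons {v y u : Word P} {vs : List (Word P)} : y ⋖ v → DownTo y vs u → DownTo v (y :: vs) u

theorem isMaximalChain_iff {u w : Word P} {C : List (Word P)} :
    IsMaximalChain u w C ↔ ∃ vs, C = w :: vs ∧ DownTo w vs u := by
  constructor
  · rintro ⟨h₁, h₂, h₃⟩
    cases C with
    | nil => simp at h₁
    | cons v vs =>
      obtain rfl : v = w := by simpa using h₁
      refine ⟨vs, rfl, ?_⟩
      clear h₁
      induction vs generalizing v with
      | nil =>
        obtain rfl : v = u := by simpa using h₂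
        exact DownTo.nil _
      | cons y vs ih =>
        rw [List.isChain_cons_cons] at h₃
        exact DownTo.cons h₃.1 (ih y (by simpa using h₂) h₃.2)
  · rintro ⟨vs, rfl, h⟩
    refine ⟨rfl, ?_, ?_⟩
    · induction h with
      | nil => rfl
      | cons _ _ ih => simpa using ih
    · induction h with
      | nil => simp
      | cons h _ ih => exact List.isChain_cons_cons.2 ⟨h, ih⟩

namespace DownTo

theorem append {v m u : Word P} {vs vs' : List (Word P)} (h : DownTo v vs m)
    (h' : DownTo m vs' u) : DownTo v (vs ++ vs') u := by
  induction h with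
  | nil => exact h'
  | cons hc _ ih => exact DownTo.cons hc (ih h')

theorem pairwise {v u : Word P} {vs : List (Word P)} (h : DownTo v vs u) :
    (v :: vs).Pairwise (fun x y => y < x) := by
  have hc : (v :: vs).IsChain (fun x y => y < x) := by
    induction h with
    | nil => simp
    | cons h _ ih => exact List.isChain_cons_cons.2 ⟨h.lt, ih⟩
  have : Trans (fun x y : Word P => y < x) (fun x y : Word P => y < x)
    (fun x y : Word P => y < x) := ⟨fun h₁ h₂ => lt_trans h₂ h₁⟩
  exact List.isChain_iff_pairwise.1 hc

theorem end_mem {v u : Word P} {vs : List (Word P)} (h : DownTo v vs u) : u ∈ v :: vs := by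
  induction h with
  | nil => simp
  | cons _ _ ih => exact List.mem_cons_of_mem _ ih

theorem end_mem_of_ne_nil {v u : Word P} {vs : List (Word P)} (h : DownTo v vs u)
    (hvs : vs ≠ []) : u ∈ vs := by
  cases h with
  | nil => exact absurd rfl hvs
  | cons _ h => exact h.end_mem

theorem lt_of_mem {v u x : Word P} {vs : List (Word P)} (h : DownTo v vs u) (hx : x ∈ vs) :
    x < v :=
  (List.pairwise_cons.1 h.pairwise).1 x hx

theorem le_of_mem {v u x : Word P} {vs : List (Word P)} (h : DownTo v vs u) (hx : x ∈ v :: vs) :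
    u ≤ x := by
  induction h generalizing x with
  | nil v =>
    obtain rfl : x = v := by simpa using hx
    exact le_rfl
  | @cons v y u vs hc h ih =>
    rcases List.mem_cons.1 hx with rfl | hx
    · exact (ih List.mem_cons_self).trans hc.lt.le
    · exact ih hx

theorem le_of_mem_top {v u x : Word P} {vs : List (Word P)} (h : DownTo v vs u)
    (hx : x ∈ v :: vs) : x ≤ v := by
  rcases List.mem_cons.1 hx with rfl | hx
  · exact le_rfl
  · exact (h.lt_of_mem hx).le

theorem le {v u : Word P} {vs : List (Word P)} (h : DownTo v vs u) : u ≤ v :=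
  h.le_of_mem List.mem_cons_self

theorem comparable {v u x y : Word P} {vs : List (Word P)} (h : DownTo v vs u)
    (hx : x ∈ v :: vs) (hy : y ∈ v :: vs) : x ≤ y ∨ y ≤ x := by
  induction h with
  | nil v =>
    obtain rfl : x = v := by simpa using hx
    obtain rfl : y = x := by simpa using hy
    exact Or.inl le_rfl
  | cons hc h ih =>
    have h' := DownTo.cons hc h
    rcases List.mem_cons.1 hx with hx | hx'
    · exact Or.inr (hx ▸ h'.le_of_mem_top hy)
    · rcases List.mem_cons.1 hy with hy | hy'
      · exact Or.inl (hy ▸ h'.le_of_mem_top hx)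
      · exact ih hx' hy'

theorem rank_eq (hP : IsRootedForest P) {v u : Word P} {vs : List (Word P)} (h : DownTo v vs u) :
    v.rank = u.rank + vs.length := by
  induction h with
  | nil => rfl
  | cons hc _ ih => rw [rank_covBy hP hc, ih, List.length_cons, add_assoc]

end DownTo

theorem exists_downTo (hP : IsRootedForest P) {u v : Word P} (h : u ≤ v) :
    ∃ vs, DownTo v vs u := by
  induction hr : v.rank generalizing v with
  | zero =>
    rcases h.eq_or_lt with rfl | h
    · exact ⟨[], DownTo.nil _⟩
    · have := rank_strictMono hP h
      omega
  | succ n ih =>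
    rcases h.eq_or_lt with rfl | h
    · exact ⟨[], DownTo.nil _⟩
    · obtain ⟨q, x, hx, hle⟩ := exists_le_update_of_lt hP ((ofNonzero_letter v).symm ▸ h)
      have hc := update_covBy (e := fun i => (v.letter i : WithBot P)) hP hx
      rw [ofNonzero_letter] at hc
      have := rank_covBy hP hc
      obtain ⟨vs, hvs⟩ := ih hle (by omega)
      exact ⟨_, DownTo.cons hc hvs⟩

/-- Every element of `[u, w]` lies on a maximal chain. -/
theorem exists_downTo_mem (hP : IsRootedForest P) {u x w : Word P} (hux : u ≤ x) (hxw : x ≤ w) :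
    ∃ vs, DownTo w vs u ∧ x ∈ w :: vs := by
  obtain ⟨vs, h⟩ := exists_downTo hP hxw
  obtain ⟨vs', h'⟩ := exists_downTo hP hux
  refine ⟨vs ++ vs', h.append h', ?_⟩
  rw [← List.cons_append]
  exact List.mem_append_left _ h.end_mem

/-- The interior of a maximal chain of `[u, w]` has `rk w - rk u - 1` elements. -/
theorem ncard_interior (hP : IsRootedForest P) {u w : Word P} {vs : List (Word P)}
    (h : DownTo w vs u) (hvs : vs ≠ []) :
    (openChainInterval (w :: vs) w u).ncard = w.rank - u.rank - 1 := by
  classical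
  have hrank := h.rank_eq hP
  have hnd : (w :: vs).Nodup := h.pairwise.imp fun h => h.ne'
  have hset : openChainInterval (w :: vs) w u =
      ((vs.toFinset.erase u : Finset (Word P)) : Set _) := by
    ext v
    simp only [openChainInterval, List.mem_cons, Set.mem_ofPred_eq, Finset.coe_erase,
      Set.mem_sdiff, List.coe_toFinset, Set.mem_singleton_iff]
    constructor
    · rintro ⟨rfl | hv, h₁, h₂⟩
      · exact absurd h₂ (lt_irrefl _)
      · exact ⟨hv, h₁.ne'⟩
    · rintro ⟨hv, hne⟩
      exact ⟨Or.inr hv, lt_of_le_of_ne (h.le_of_mem (List.mem_cons_of_mem _ hv)) (Ne.symm hne),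
        h.lt_of_mem hv⟩
  rw [hset, Set.ncard_coe_finset, Finset.card_erase_of_mem
    (List.mem_toFinset.2 (h.end_mem_of_ne_nil hvs)),
    List.toFinset_card_of_nodup (List.nodup_cons.1 hnd).2]
  omega

/-- `Run e vs ps e'`: starting from the embedding `e` and going down along the words `vs`, the
labels are `ps` and the canonical embedding of the last word is `e'`. -/
inductive Run {n : ℕ} :
    (Fin n → WithBot P) → List (Word P) → List (Fin n) → (Fin n → WithBot P) → Prop
  | nil (e : Fin n → WithBot P) : Run e [] [] e
  | cons {e e' e'' : Fin n → WithBot P} {v : Word P} {p : Fin n} {vs : List (Word P)}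
      {ps : List (Fin n)} :
      IsLabelStep e v p e' → Run e' vs ps e'' → Run e (v :: vs) (p :: ps) e''

theorem labelsFrom_iff {n : ℕ} {e : Fin n → WithBot P} {vs : List (Word P)} {ps : List (Fin n)} :
    LabelsFrom e vs ps ↔ ∃ e', Run e vs ps e' := by
  constructor
  · intro h
    induction h with
    | nil e => exact ⟨e, Run.nil e⟩
    | cons hs _ ih =>
      obtain ⟨e'', h⟩ := ih
      exact ⟨e'', Run.cons hs h⟩
  · rintro ⟨e', h⟩
    induction h with
    | nil e => exact LabelsFrom.nil e
    | cons hs _ ih => exact LabelsFrom.cons hs ih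

theorem IsLabelStep.covBy (hP : IsRootedForest P) {n : ℕ} {e e' : Fin n → WithBot P} {v : Word P}
    {p : Fin n} (h : IsLabelStep e v p e') : v ⋖ ofNonzero e := by
  obtain ⟨⟨x, hx, rfl⟩, rfl, -⟩ := h
  exact update_covBy hP hx

theorem exists_isLabelStep (hP : IsRootedForest P) {n : ℕ} {e : Fin n → WithBot P} {v : Word P}
    (h : v ⋖ ofNonzero e) : ∃ p e', IsLabelStep e v p e' := by
  obtain ⟨q, hq⟩ := exists_update_eq_of_covBy hP h
  obtain ⟨p, ⟨x, hx, hp⟩, hmin⟩ := WellFounded.has_min (wellFounded_lt (α := Fin n))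
    {q | ∃ x, x ⋖ e q ∧ ofNonzero (Function.update e q x) = v} ⟨q, hq⟩
  exact ⟨p, _, ⟨x, hx, rfl⟩, hp, fun q hq => not_lt.1 (hmin q hq)⟩

theorem IsLabelStep.eq_of_label (hP : IsRootedForest P) {n : ℕ} {e e₁ e₂ : Fin n → WithBot P}
    {v₁ v₂ : Word P} {p : Fin n} (h₁ : IsLabelStep e v₁ p e₁) (h₂ : IsLabelStep e v₂ p e₂) :
    v₁ = v₂ ∧ e₁ = e₂ := by
  obtain ⟨⟨x, hx, rfl⟩, rfl, -⟩ := h₁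
  obtain ⟨⟨y, hy, rfl⟩, rfl, -⟩ := h₂
  rw [covBy_unique hP hx hy]
  exact ⟨rfl, rfl⟩

theorem IsLabelStep.eq_of_word (hP : IsRootedForest P) {n : ℕ} {e e₁ e₂ : Fin n → WithBot P}
    {v : Word P} {p q : Fin n} (h₁ : IsLabelStep e v p e₁) (h₂ : IsLabelStep e v q e₂) :
    p = q ∧ e₁ = e₂ := by
  obtain ⟨x, hx, hx'⟩ := h₁.1
  obtain ⟨y, hy, hy'⟩ := h₂.1
  have hpq : p = q := le_antisymm (h₁.2.2 q ⟨y, hy, hy' ▸ h₂.2.1⟩)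
    (h₂.2.2 p ⟨x, hx, hx' ▸ h₁.2.1⟩)
  subst hpq
  exact ⟨rfl, (h₁.eq_of_label hP h₂).2⟩

namespace Run

variable {n : ℕ} {e e' e'' : Fin n → WithBot P} {vs vs' : List (Word P)} {ps ps' : List (Fin n)}

theorem append (h : Run e vs ps e') (h' : Run e' vs' ps' e'') :
    Run e (vs ++ vs') (ps ++ ps') e'' := by
  induction h with
  | nil => exact h'
  | cons hs _ ih => exact Run.cons hs (ih h')

theorem exists_split (h : Run e vs (ps ++ ps') e'') :
    ∃ vs₁ vs₂ e', vs = vs₁ ++ vs₂ ∧ Run e vs₁ ps e' ∧ Run e' vs₂ ps' e'' := by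
  induction ps generalizing e vs with
  | nil => exact ⟨[], vs, e, rfl, Run.nil e, h⟩
  | cons p ps ih =>
    cases h with
    | cons hs h =>
      obtain ⟨vs₁, vs₂, e', rfl, h₁, h₂⟩ := ih h
      exact ⟨_ :: vs₁, vs₂, e', rfl, Run.cons hs h₁, h₂⟩

theorem length_eq (h : Run e vs ps e') : vs.length = ps.length := by
  induction h with
  | nil => rfl
  | cons _ _ ih => simp [ih]

theorem downTo (hP : IsRootedForest P) (h : Run e vs ps e') :
    DownTo (ofNonzero e) vs (ofNonzero e') := by
  induction h with
  | nil => exact DownTo.nil _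
  | cons hs _ ih =>
    have := hs.covBy hP
    rw [← hs.2.1] at this ⊢
    exact DownTo.cons this ih

theorem unique_labels (hP : IsRootedForest P) (h : Run e vs ps e') (h' : Run e vs ps' e'') :
    ps = ps' ∧ e' = e'' := by
  induction h generalizing ps' with
  | nil => cases h'; exact ⟨rfl, rfl⟩
  | cons hs _ ih =>
    cases h' with
    | cons hs' h' =>
      obtain ⟨rfl, rfl⟩ := hs.eq_of_word hP hs'
      obtain ⟨rfl, rfl⟩ := ih h'
      exact ⟨rfl, rfl⟩

theorem unique_words (hP : IsRootedForest P) (h : Run e vs ps e') (h' : Run e vs' ps e'') :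
    vs = vs' ∧ e' = e'' := by
  induction h generalizing vs' with
  | nil => cases h'; exact ⟨rfl, rfl⟩
  | cons hs _ ih =>
    cases h' with
    | cons hs' h' =>
      obtain ⟨rfl, rfl⟩ := hs.eq_of_label hP hs'
      obtain ⟨rfl, rfl⟩ := ih h'
      exact ⟨rfl, rfl⟩

theorem apply_eq (h : Run e vs ps e') {i : Fin n} (hi : i ∉ ps) : e' i = e i := by
  induction h with
  | nil => rfl
  | cons hs _ ih =>
    obtain ⟨x, hx, rfl⟩ := hs.1
    rw [List.mem_cons, not_or] at hi
    rw [ih hi.2, Function.update_of_ne hi.1]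

end Run

theorem exists_run (hP : IsRootedForest P) {n : ℕ} {e : Fin n → WithBot P} {vs : List (Word P)}
    {u : Word P} (h : DownTo (ofNonzero e) vs u) : ∃ ps e', Run e vs ps e' ∧ ofNonzero e' = u := by
  induction vs generalizing e with
  | nil => cases h; exact ⟨[], e, Run.nil e, rfl⟩
  | cons v vs ih =>
    cases h with
    | cons hc h =>
      obtain ⟨p, e', hs⟩ := exists_isLabelStep hP hc
      rw [← hs.2.1] at h
      obtain ⟨ps, e'', hr, hu⟩ := ih h
      exact ⟨p :: ps, e'', Run.cons hs hr, hu⟩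

/-- Every maximal chain of `[u, w]` has a position labeling. -/
theorem exists_run_letter (hP : IsRootedForest P) {u w : Word P} {vs : List (Word P)}
    (h : DownTo w vs u) :
    ∃ ps e', Run (fun i => (w.letter i : WithBot P)) vs ps e' ∧ ofNonzero e' = u :=
  exists_run hP ((ofNonzero_letter w).symm ▸ h)

end Chains

/-! ### A disconnected interval has a maximal minimal skipped interval -/

section Disconnected

variable {P : Type*} [PartialOrder P]

theorem chainBefore_iff (hP : IsRootedForest P) {w : Word P} {vs vs' : List (Word P)}
    {ps : List (Fin w.length)} {e' : Fin w.length → WithBot P}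
    (h : Run (fun i => (w.letter i : WithBot P)) vs ps e') :
    ChainBefore w (w :: vs') (w :: vs) ↔
      ∃ qs e'', Run (fun i => (w.letter i : WithBot P)) vs' qs e'' ∧ qs < ps := by
  constructor
  · rintro ⟨qs, ps', h₁, h₂, hlt⟩
    obtain ⟨e₁, h₁⟩ := labelsFrom_iff.1 h₁
    obtain ⟨e₂, h₂⟩ := labelsFrom_iff.1 h₂
    obtain ⟨rfl, -⟩ := h.unique_labels hP h₂
    exact ⟨qs, e₁, h₁, hlt⟩
  · rintro ⟨qs, e'', h', hlt⟩
    exact ⟨qs, ps, labelsFrom_iff.2 ⟨_, h'⟩, labelsFrom_iff.2 ⟨_, h⟩, hlt⟩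

/-- A nonempty set of maximal chains contains one with the smallest label sequence. -/
theorem exists_min_run (hP : IsRootedForest P) {u w : Word P} (p : List (Word P) → Prop)
    (h : ∃ vs, DownTo w vs u ∧ p vs) :
    ∃ vs ps e', DownTo w vs u ∧ p vs ∧ Run (fun i => (w.letter i : WithBot P)) vs ps e' ∧
      ∀ vs' ps' e'', DownTo w vs' u → p vs' →
        Run (fun i => (w.letter i : WithBot P)) vs' ps' e'' → ps ≤ ps' := by
  set s : Set (List (Fin w.length)) := {ps | ∃ vs e', DownTo w vs u ∧ p vs ∧
    Run (fun i => (w.letter i : WithBot P)) vs ps e'} with hs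
  have hfin : s.Finite := by
    refine (List.finite_length_eq (Fin w.length) (w.rank - u.rank)).subset ?_
    rintro ps ⟨vs, e', hd, -, hr⟩
    have := hd.rank_eq hP
    have := hr.length_eq
    simp only [Set.mem_ofPred_eq]
    omega
  obtain ⟨vs, hd, hp⟩ := h
  obtain ⟨ps, e', hr, -⟩ := exists_run_letter hP hd
  obtain ⟨ps, ⟨vs, e', hd, hp, hr⟩, hmin⟩ := Set.exists_min_image s id hfin ⟨ps, vs, e', hd, hp, hr⟩
  exact ⟨vs, ps, e', hd, hp, hr, fun vs' ps' e'' h₁ h₂ h₃ => hmin ps' ⟨vs', e'', h₁, h₂, h₃⟩⟩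

/-- Suppose that no element of the part `A` of the open interval is comparable with an element
outside `A`, and that the first maximal chain does not meet `A`. Then the whole interior of the
first maximal chain that meets `A` is a minimal skipped interval: a chain before it that shares an
interior element with it would meet `A` too. -/
theorem exists_isMinimalSkippedInterval_of_separating (hP : IsRootedForest P) {u w : Word P}
    {A : Set (Word P)}
    (hA : ∀ x ∈ Set.Ioo u w, ∀ y ∈ Set.Ioo u w, x ≤ y → (x ∈ A ↔ y ∈ A))
    {x : Word P} (hx : x ∈ Set.Ioo u w) (hxA : x ∈ A)
    {vs₀ : List (Word P)} {ps₀ : List (Fin w.length)} {e₀ : Fin w.length → WithBot P}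
    (hd₀ : DownTo w vs₀ u) (hr₀ : Run (fun i => (w.letter i : WithBot P)) vs₀ ps₀ e₀)
    (hmin₀ : ∀ vs' ps' e'', DownTo w vs' u →
        Run (fun i => (w.letter i : WithBot P)) vs' ps' e'' → ps₀ ≤ ps')
    {v₀ : Word P} (hv₀ : v₀ ∈ vs₀) (hv₀u : u < v₀) (hv₀A : v₀ ∉ A) :
    ∃ (C : List (Word P)) (I : Set (Word P)), IsMaximalChain u w C ∧
      IsMinimalSkippedInterval u w C I ∧ I.ncard = w.rank - u.rank - 1 := by
  have hsame : ∀ vs, DownTo w vs u → ∀ a ∈ vs, ∀ b ∈ vs, u < a → u < b → a ∈ A → b ∈ A := by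
    intro vs hd a ha b hb hua hub haA
    have ha' : a ∈ Set.Ioo u w := ⟨hua, hd.lt_of_mem ha⟩
    have hb' : b ∈ Set.Ioo u w := ⟨hub, hd.lt_of_mem hb⟩
    rcases hd.comparable (List.mem_cons_of_mem _ ha) (List.mem_cons_of_mem _ hb) with h | h
    · exact (hA a ha' b hb' h).1 haA
    · exact (hA b hb' a ha' h).2 haA
  obtain ⟨vs, ps, e, hd, ⟨a, ha, hua, haA⟩, hr, hmin⟩ := exists_min_run hP
    (u := u) (w := w) (fun vs => ∃ a ∈ vs, u < a ∧ a ∈ A) (by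
      obtain ⟨vs, hd, hmem⟩ := exists_downTo_mem hP hx.1.le hx.2.le
      refine ⟨vs, hd, x, ?_, hx.1, hxA⟩
      rcases List.mem_cons.1 hmem with h | h
      · exact absurd h hx.2.ne
      · exact h)
  have hvs : vs ≠ [] := List.ne_nil_of_mem ha
  refine ⟨w :: vs, openChainInterval (w :: vs) w u, isMaximalChain_iff.2 ⟨vs, rfl, hd⟩,
    ⟨⟨⟨w, List.mem_cons_self, u, hd.end_mem, rfl⟩, w :: vs₀,
      isMaximalChain_iff.2 ⟨vs₀, rfl, hd₀⟩, ?_, ?_⟩, ?_⟩, ncard_interior hP hd hvs⟩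
  · refine (chainBefore_iff hP hr).2 ⟨ps₀, e₀, hr₀, lt_of_le_of_ne (hmin₀ _ _ _ hd hr) ?_⟩
    rintro rfl
    obtain ⟨rfl, -⟩ := hr.unique_words hP hr₀
    exact hv₀A (hsame _ hd a ha v₀ hv₀ hua hv₀u haA)
  · intro v hv hvI
    by_cases h₁ : v = w
    · subst h₁; exact List.mem_cons_self
    by_cases h₂ : v = u
    · subst h₂; exact hd₀.end_mem
    · exact absurd ⟨hv, lt_of_le_of_ne (hd.le_of_mem hv) (Ne.symm h₂),
        lt_of_le_of_ne (hd.le_of_mem_top hv) h₁⟩ hvI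
  · rintro J ⟨-, B, hB, hBC, hJB⟩ hJ
    obtain ⟨vs', rfl, hd'⟩ := isMaximalChain_iff.1 hB
    obtain ⟨qs, e'', hr', hlt⟩ := (chainBefore_iff hP hr).1 hBC
    obtain ⟨v, ⟨hvC, huv, hvw⟩, hvJ⟩ := Set.exists_of_ssubset hJ
    have hvB : v ∈ vs' := (List.mem_cons.1 (hJB v hvC hvJ)).resolve_left hvw.ne
    have hvvs : v ∈ vs := (List.mem_cons.1 hvC).resolve_left hvw.ne
    have hvA := hsame _ hd a ha v hvvs hua huv haA
    exact hlt.not_ge (hmin vs' qs e'' hd' ⟨v, hvB, huv, hvA⟩ hr')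

theorem exists_isMinimalSkippedInterval (hP : IsRootedForest P) {u w : Word P}
    (h : IsDisconnectedInterval u w) :
    ∃ (C : List (Word P)) (I : Set (Word P)), IsMaximalChain u w C ∧
      IsMinimalSkippedInterval u w C I ∧ I.ncard = w.rank - u.rank - 1 := by
  obtain ⟨A, ⟨x, hx, hxA⟩, ⟨y, hy, hyA⟩, hA⟩ := isDisconnectedInterval_iff.1 h
  obtain ⟨vs₀, ps₀, e₀, hd₀, -, hr₀, hmin₀⟩ := exists_min_run hP (u := u) (w := w)
    (fun _ => True) (by
      obtain ⟨vs, hd⟩ := exists_downTo hP (hx.1.trans hx.2).le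
      exact ⟨vs, hd, trivial⟩)
  -- the interval has an interior element, so the first element of the chain below `w` is not `u`
  obtain ⟨v₀, hv₀, huv₀⟩ : ∃ v ∈ vs₀, u < v := by
    cases hd₀ with
    | nil => exact absurd (hx.1.trans hx.2) (lt_irrefl _)
    | @cons _ v _ vs hc hd =>
      refine ⟨v, List.mem_cons_self, lt_of_le_of_ne hd.le ?_⟩
      rintro rfl
      exact hc.2 hx.1 hx.2
  by_cases hv₀A : v₀ ∈ A
  · exact exists_isMinimalSkippedInterval_of_separating hP (A := Aᶜ)
      (fun a ha b hb hab => not_congr (hA a ha b hb hab)) hy hyA hd₀ hr₀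
      (fun vs' ps' e'' h₁ h₂ => hmin₀ vs' ps' e'' h₁ trivial h₂) hv₀ huv₀ (fun h => h hv₀A)
  · exact exists_isMinimalSkippedInterval_of_separating hP hA hx hxA hd₀ hr₀
      (fun vs' ps' e'' h₁ h₂ => hmin₀ vs' ps' e'' h₁ trivial h₂) hv₀ huv₀ hv₀A

end Disconnected

/-! ### A maximal minimal skipped interval forces a repeated letter -/

section Critical

variable {P : Type*} [PartialOrder P]

/-- Let a saturated segment from `v` to `v'` of a maximal chain, other than the whole chain, begin
with the label `p`. If decreasing the canonical embedding of `v` in a position left of `p` gave a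
word above `v'`, then the chain could be replaced by an earlier one between `v` and `v'`; so the
interior would not be a minimal skipped interval. -/
theorem not_le_update (hP : IsRootedForest P) {u w : Word P} {vs₁ vs₂ vs₃ : List (Word P)}
    {e₁ e₂ e₃ : Fin w.length → WithBot P} {p : Fin w.length} {ps₁ ps₂ ps₃ : List (Fin w.length)}
    (h₁ : Run (fun i => (w.letter i : WithBot P)) vs₁ ps₁ e₁) (h₂ : Run e₁ vs₂ (p :: ps₂) e₂)
    (h₃ : Run e₂ vs₃ ps₃ e₃) (hu : ofNonzero e₃ = u)
    (hmin : ∀ J, IsSkippedInterval u w (w :: (vs₁ ++ (vs₂ ++ vs₃))) J →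
      ¬ J ⊂ openChainInterval (w :: (vs₁ ++ (vs₂ ++ vs₃))) w u)
    (hproper : ps₁ ≠ [] ∨ ps₃ ≠ []) {q : Fin w.length} (hq : q < p) {x : WithBot P}
    (hx : x ⋖ e₁ q) : ¬ ofNonzero e₂ ≤ ofNonzero (Function.update e₁ q x) := by
  intro hle
  subst hu
  have d₁ : DownTo w vs₁ (ofNonzero e₁) := by simpa using h₁.downTo hP
  have d₂ := h₂.downTo hP
  have d₃ := h₃.downTo hP
  have d := d₁.append (d₂.append d₃)
  have hr := h₁.append (h₂.append h₃)
  have hvs₂ : vs₂ ≠ [] := by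
    rintro rfl
    cases h₂
  have h21 : ofNonzero e₂ < ofNonzero e₁ := d₂.lt_of_mem (d₂.end_mem_of_ne_nil hvs₂)
  have m₁ : ofNonzero e₁ ∈ w :: (vs₁ ++ (vs₂ ++ vs₃)) :=
    List.mem_append_left (as := w :: vs₁) _ d₁.end_mem
  have m₂ : ofNonzero e₂ ∈ vs₁ ++ (vs₂ ++ vs₃) :=
    List.mem_append_right _ (List.mem_append_left _ (d₂.end_mem_of_ne_nil hvs₂))
  refine hmin (openChainInterval (w :: (vs₁ ++ (vs₂ ++ vs₃))) (ofNonzero e₁) (ofNonzero e₂))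
    ⟨⟨_, m₁, _, List.mem_cons_of_mem _ m₂, rfl⟩, ?_⟩ ?_
  · -- the earlier chain through the word decreased in position `q`
    have hc := update_covBy hP hx
    obtain ⟨D, hD⟩ := exists_downTo hP hle
    obtain ⟨p', e', hs⟩ := exists_isLabelStep hP hc
    have hp' : p' < p := (hs.2.2 q ⟨x, hx, rfl⟩).trans_lt hq
    have hD3 := hD.append d₃
    obtain ⟨qs, e'', hrun, -⟩ := exists_run hP (hs.2.1.symm ▸ hD3)
    refine ⟨w :: (vs₁ ++ (ofNonzero (Function.update e₁ q x) :: (D ++ vs₃))),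
      isMaximalChain_iff.2 ⟨_, rfl, d₁.append (DownTo.cons hc hD3)⟩,
      (chainBefore_iff hP hr).2 ⟨_, e'', h₁.append (Run.cons hs hrun), ?_⟩, ?_⟩
    · exact List.Lex.append_left _ (List.Lex.rel hp') _
    · intro v hv hvJ
      rw [List.mem_cons, List.mem_append, List.mem_append] at hv
      rw [List.mem_cons, List.mem_append, List.mem_cons, List.mem_append]
      rcases hv with hv | hv | hv | hv
      · exact Or.inl hv
      · exact Or.inr (Or.inl hv)
      · have hve : v = ofNonzero e₂ := by
          by_contra hne
          exact hvJ ⟨List.mem_cons_of_mem _ (List.mem_append_right _ (List.mem_append_left _ hv)),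
            lt_of_le_of_ne (d₂.le_of_mem (List.mem_cons_of_mem _ hv)) (Ne.symm hne),
            d₂.lt_of_mem hv⟩
        subst hve
        rcases List.mem_cons.1 hD.end_mem with h | h
        · exact Or.inr (Or.inr (Or.inl h))
        · exact Or.inr (Or.inr (Or.inr (Or.inl h)))
      · exact Or.inr (Or.inr (Or.inr (Or.inr hv)))
  · refine Set.ssubset_iff_subset_ne.2
      ⟨fun v ⟨hv, h, h'⟩ => ⟨hv, d₃.le.trans_lt h, h'.trans_le d₁.le⟩, fun hJ => ?_⟩
    rcases hproper with hp | hp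
    · have hvs₁ : vs₁ ≠ [] := by
        rintro rfl
        cases h₁
        exact hp rfl
      have : ofNonzero e₁ ∈ openChainInterval (w :: (vs₁ ++ (vs₂ ++ vs₃))) w (ofNonzero e₃) :=
        ⟨m₁, d₃.le.trans_lt h21, d₁.lt_of_mem (d₁.end_mem_of_ne_nil hvs₁)⟩
      rw [← hJ] at this
      exact lt_irrefl _ this.2.2
    · have hvs₃ : vs₃ ≠ [] := by
        rintro rfl
        cases h₃
        exact hp rfl
      have : ofNonzero e₂ ∈ openChainInterval (w :: (vs₁ ++ (vs₂ ++ vs₃))) w (ofNonzero e₃) :=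
        ⟨List.mem_cons_of_mem _ m₂, d₃.lt_of_mem (d₃.end_mem_of_ne_nil hvs₃),
          h21.trans_le d₁.le⟩
      rw [← hJ] at this
      exact lt_irrefl _ this.2.1

/-- Of two sequences of the same length, the lexicographically smaller one has the smaller entry at
the first difference. -/
theorem exists_of_lex {α : Type*} [LT α] {l m : List α} (h : List.Lex (· < ·) l m)
    (hlen : l.length = m.length) :
    ∃ k a b l' m', l = k ++ a :: l' ∧ m = k ++ b :: m' ∧ a < b := by
  induction h with
  | nil => simp at hlen
  | rel h => exact ⟨[], _, _, _, _, rfl, rfl, h⟩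
  | @cons a l m _ ih =>
    obtain ⟨k, b, c, l', m', rfl, rfl, hbc⟩ := ih (by simpa using hlen)
    exact ⟨a :: k, b, c, l', m', rfl, rfl, hbc⟩

theorem le_nonzero_cons (x : WithBot P) (l : List (WithBot P)) :
    Word.mk (nonzero l) ≤ Word.mk (nonzero (x :: l)) :=
  nonzero_cons_le_cons (x := ⊥) bot_le le_rfl

theorem nonzero_set_lt (hP : IsRootedForest P) {H : List P} {b : ℕ} (hb : b < H.length)
    {x : WithBot P} (hx : x ⋖ (H[b] : WithBot P)) :
    Word.mk (nonzero ((H.map (↑)).set b x)) < Word.mk H := by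
  have h := (update_covBy (e := fun i => ((Word.mk H).letter i : WithBot P)) (q := ⟨b, hb⟩)
    hP hx).lt
  rwa [ofNonzero_letter, ofNonzero_eq, ofFn_update, ofFn_letter] at h

theorem forall_eq_or_exists_append {α : Type*} (p : α) (l : List α) :
    (∀ q ∈ l, q = p) ∨ ∃ A s B, l = A ++ s :: B ∧ (∀ q ∈ A, q = p) ∧ s ≠ p := by
  classical
  induction l with
  | nil => simp
  | cons a l ih =>
    by_cases ha : a = p
    · subst ha
      rcases ih with h | ⟨A, s, B, rfl, hA, hs⟩
      · exact Or.inl (by simpa using h)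
      · exact Or.inr ⟨a :: A, s, B, rfl, by simpa using hA, hs⟩
    · exact Or.inr ⟨[], a, l, rfl, by simp, ha⟩

theorem Run.eq_update {n : ℕ} {e e' : Fin n → WithBot P} {vs : List (Word P)} {ps : List (Fin n)}
    (h : Run e vs ps e') {p : Fin n} (hp : ∀ q ∈ ps, q = p) :
    e' = Function.update e p (e' p) := by
  funext i
  by_cases hi : i = p
  · subst hi; simp
  · rw [Function.update_of_ne hi]
    exact h.apply_eq fun him => hi (hp i him)

/-- The combinatorial core. Let `ps` be the labels of a maximal chain, and suppose that
* decreasing a letter to the left of the first label `p` of a proper segment of the chain never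
  leads to a word above the lower end of that segment, but that
* this does happen for the whole chain.

The labels increase weakly, since a descent could be swapped. So `u` and `w` have a common initial
segment of length `p`, and by the second assumption its last letter can be embedded in the remaining
positions of `w`. By the first assumption, applied below the top edge, this last letter equals the
letter of `w` in position `p`. Then all labels are equal to `p`: otherwise, where the label `p` is
left, the letter in position `p` has either been deleted, and the upper part of the chain violates
the first assumption, or it has not, and the lower part does. -/
theorem exists_repeated_letter_of_run (hP : IsRootedForest P) {u w : Word P}
    {vs : List (Word P)} {ps : List (Fin w.length)} {e' : Fin w.length → WithBot P}
    (hr : Run (fun i => (w.letter i : WithBot P)) vs ps e') (hu : ofNonzero e' = u)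
    (hlen : 3 ≤ ps.length)
    (hM : ∀ ps₁ p ps₂ ps₃, ps = ps₁ ++ ((p :: ps₂) ++ ps₃) → (ps₁ ≠ [] ∨ ps₃ ≠ []) →
      ∃ vs₁ vs₂ vs₃ e₁ e₂, Run (fun i => (w.letter i : WithBot P)) vs₁ ps₁ e₁ ∧
        Run e₁ vs₂ (p :: ps₂) e₂ ∧ Run e₂ vs₃ ps₃ e' ∧
        ∀ q < p, ∀ x, x ⋖ e₁ q → ¬ ofNonzero e₂ ≤ ofNonzero (Function.update e₁ q x))
    (hN : ∀ p rest, ps = p :: rest → ∃ b < p, ∃ x, x ⋖ (w.letter b : WithBot P) ∧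
      u ≤ ofNonzero (Function.update (fun i => (w.letter i : WithBot P)) b x)) :
    ∃ (a : P) (v₁ v₂ : List P),
      u.letters = v₁ ++ [a] ++ v₂ ∧ w.letters = v₁ ++ [a, a] ++ v₂ := by
  -- the labels increase weakly
  have hinc : ps.IsChain (· ≤ ·) := by
    rw [List.isChain_iff_forall_rel_of_append_cons_cons]
    intro a b l₁ l₂ hl
    by_contra hab
    have hprop : l₁ ≠ [] ∨ l₂ ≠ [] := by
      by_contra hcon
      push Not at hcon
      rw [hl, hcon.1, hcon.2] at hlen
      simp at hlen
    obtain ⟨_, _, _, e₁, e₂, -, h₂, -, h⟩ := hM l₁ a [b] l₂ (by simpa using hl) hprop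
    cases h₂ with
    | cons s₁ h₂ =>
      cases h₂ with
      | cons s₂ h₂ =>
        cases h₂
        obtain ⟨x₁, hx₁, rfl⟩ := s₁.1
        obtain ⟨x₂, hx₂, rfl⟩ := s₂.1
        have hne : b ≠ a := fun h => hab h.ge
        rw [Function.update_of_ne hne] at hx₂
        refine h b (not_le.1 hab) x₂ hx₂ (ofNonzero_mono fun i => ?_)
        by_cases hi : i = b
        · subst hi; simp
        · rw [Function.update_of_ne hi, Function.update_of_ne hi]
          exact update_le hx₁.le i
  obtain ⟨p, rest, rfl⟩ : ∃ p rest, ps = p :: rest := by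
    cases ps with
    | nil => simp at hlen
    | cons p rest => exact ⟨p, rest, rfl⟩
  have hge : ∀ q ∈ rest, p ≤ q :=
    (List.pairwise_cons.1 (List.isChain_iff_pairwise.1 hinc)).1
  set e₀ : Fin w.length → WithBot P := fun i => (w.letter i : WithBot P) with he₀
  -- split `w` in position `p`
  obtain ⟨H, c, T, hw, hH⟩ : ∃ H c T, w.letters = H ++ c :: T ∧ H.length = (p : ℕ) := by
    have hp : (p : ℕ) < w.letters.length := p.2
    refine ⟨w.letters.take p, w.letters[(p : ℕ)], w.letters.drop (p + 1), ?_, ?_⟩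
    · rw [List.getElem_cons_drop, List.take_append_drop]
    · rw [List.length_take]; omega
  have hL₀ : List.ofFn e₀ = H.map (↑) ++ (c : WithBot P) :: T.map (↑) := by
    rw [he₀, ofFn_letter, hw]; simp
  have he₀p : e₀ p = c := apply_of_ofFn hL₀ (by simpa using hH)
  -- `u` and `w` agree left of `p`
  obtain ⟨t, ht⟩ : ∃ t, u = ⟨H ++ t⟩ := by
    refine ⟨nonzero ((List.ofFn e').drop p), ?_⟩
    have htake : (List.ofFn e').take p = (List.ofFn e₀).take p := by
      apply List.ext_getElem
      · simp
      · intro i h₁ h₂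
        simp only [List.getElem_take, List.getElem_ofFn]
        refine hr.apply_eq fun hmem => ?_
        have hip : i < (p : ℕ) := by
          rw [List.length_take] at h₁; omega
        rcases List.mem_cons.1 hmem with h | h
        · exact hip.ne (congrArg Fin.val h)
        · exact hip.not_ge (hge _ h)
    have hH' : (List.ofFn e₀).take p = H.map (↑) := by
      rw [hL₀, ← hH]; simp
    have hsplit := congrArg nonzero (List.take_append_drop p (List.ofFn e'))
    rw [nonzero_append, htake, hH', nonzero_map_coe] at hsplit
    rw [hsplit, ← hu, ofNonzero_eq]
  -- the last letter of the common initial segment can be embedded in the remaining positions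
  obtain ⟨G, l, rfl, hlt⟩ : ∃ G l, H = G ++ [l] ∧ Word.mk (l :: t) ≤ Word.mk (c :: T) := by
    obtain ⟨b, hbp, x, hx, hle⟩ := hN p rest rfl
    have hbH : (b : ℕ) < H.length := hH ▸ hbp
    have hxb : x ⋖ (H[(b : ℕ)] : WithBot P) := by
      have : w.letter b = H[(b : ℕ)] := by
        change w.letters[(b : ℕ)]'b.2 = _
        simp only [hw]
        rw [List.getElem_append_left hbH]
      rwa [← this]
    have hset := nonzero_set_lt hP hbH hxb
    rw [ofNonzero_eq, ofFn_update, hL₀, List.set_append_left _ _ (by simpa using hbH),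
      nonzero_append, nonzero_coe_cons, nonzero_map_coe, ht] at hle
    exact exists_of_append_le_append hle (mk_length_le hset.le) hset.not_ge
  have hG : G.length < (p : ℕ) := by rw [← hH]; simp
  set q : Fin w.length := ⟨G.length, hG.trans p.2⟩ with hq
  have hqp : q < p := hG
  obtain ⟨x, hx, -⟩ := exists_le_covBy hP (WithBot.bot_lt_coe l)
  have hcT : l = c ∧ Word.mk t ≤ Word.mk T := by
    obtain ⟨p₂, rest', rfl⟩ : ∃ p₂ rest', rest = p₂ :: rest' := by
      cases rest with
      | nil => simp at hlen
      | cons p rest => exact ⟨p, rest, rfl⟩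
    obtain ⟨_, _, _, e₁, e₂, h₁, -, h₃, h⟩ := hM [p] p₂ rest' [] (by simp) (by simp)
    cases h₃
    cases h₁ with
    | cons s h₁ =>
      cases h₁
      obtain ⟨c', hc', rfl⟩ := s.1
      rw [he₀p] at hc'
      have hL₁ : List.ofFn (Function.update e₀ p c') =
          G.map (↑) ++ (l : WithBot P) :: c' :: T.map (↑) := by
        rw [ofFn_update_of_eq c' hL₀ (by simpa using hH)]; simp
      have hnot := h q (hqp.trans_le (hge _ List.mem_cons_self)) x
        (by rwa [apply_of_ofFn hL₁ (by simp [hq])])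
      rw [ofNonzero_eq (Function.update _ q x), ofFn_update_of_eq x hL₁ (by simp [hq]), hu, ht,
        nonzero_append, nonzero_map_coe, List.append_assoc] at hnot
      have hnot' : ¬ Word.mk (l :: t) ≤ Word.mk (nonzero (c' :: T.map (↑))) := fun h' =>
        hnot (append_le_append le_rfl (h'.trans (le_nonzero_cons x _)))
      rcases cons_le_cons_iff.1 hlt with ⟨hlc, htT⟩ | hlT
      · refine ⟨by_contra fun hne => hnot' ?_, htT⟩
        have hlc' : (l : WithBot P) ≤ c' :=
          le_of_lt_of_covBy hP hc' (WithBot.coe_lt_coe.2 (lt_of_le_of_ne hlc hne))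
        rw [← nonzero_map_coe t, ← nonzero_coe_cons]
        exact nonzero_cons_le_cons hlc' (by simpa using htT)
      · refine absurd (hlT.trans ?_) hnot'
        simpa using le_nonzero_cons c' (T.map (↑))
  obtain ⟨rfl, htT⟩ := hcT
  -- the list of letters after the initial run of labels `p`
  have hLr : ∀ {vs₁ A} {e : Fin w.length → WithBot P}, Run e₀ vs₁ (p :: A) e → (∀ q ∈ A, q = p) →
      List.ofFn e = (G ++ [l]).map (↑) ++ e p :: T.map (↑) := by
    intro vs₁ A e h hA
    rw [h.eq_update (p := p) (by simpa using hA)]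
    rw [ofFn_update_of_eq _ hL₀ (by simpa using hH), Function.update_self]
  rcases forall_eq_or_exists_append p rest with hall | ⟨A, s, B, rfl, hA, hs⟩
  · have hL := hLr hr hall
    cases hd : e' p with
    | bot =>
      rw [ofNonzero_eq, hL, hd] at hu
      refine ⟨l, G, T, ?_, by simpa using hw⟩
      rw [← hu]
      simp
    | coe d =>
      rw [ofNonzero_eq, hL, hd, ht] at hu
      simp only [nonzero_append, nonzero_map_coe, nonzero_coe_cons, Word.mk.injEq,
        List.append_cancel_left_eq] at hu
      have := mk_length_le htT
      rw [← hu] at this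
      simp at this
  · exfalso
    have hps : p < s := lt_of_le_of_ne (hge s (by simp)) (Ne.symm hs)
    obtain ⟨_, _, _, e₁, e₂, h₁, -, h₃, h⟩ := hM (p :: A) s B [] (by simp) (by simp)
    cases h₃
    have hL := hLr h₁ hA
    cases hd : e₁ p with
    | bot =>
      obtain ⟨_, _, _, e₀', e₁', h₀', h₁', -, h'⟩ := hM [] p A (s :: B) (by simp) (by simp)
      cases h₀'
      obtain ⟨-, rfl⟩ := h₁.unique_words hP h₁'
      have hL₀' : List.ofFn e₀ = G.map (↑) ++ (l : WithBot P) :: l :: T.map (↑) := by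
        rw [hL₀]; simp
      refine h' q hqp x (by rwa [apply_of_ofFn hL₀' (by simp [hq])]) ?_
      rw [ofNonzero_eq, hL, hd, ofNonzero_eq, ofFn_update_of_eq x hL₀' (by simp [hq])]
      simp only [List.map_append, List.map_cons, List.map_nil, nonzero_append, nonzero_map_coe,
        nonzero_bot_cons, nonzero_coe_cons, List.append_assoc, List.cons_append,
        List.nil_append]
      refine append_le_append le_rfl ?_
      simpa using le_nonzero_cons x ((l : WithBot P) :: T.map (↑))
    | coe d =>
      obtain ⟨y, hy, -⟩ := exists_le_covBy hP (WithBot.bot_lt_coe d)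
      refine h p hps y (hd ▸ hy) ?_
      rw [hu, ht, ofNonzero_eq, ofFn_update_of_eq y hL (by simpa using hH), nonzero_append,
        nonzero_map_coe]
      refine append_le_append le_rfl (htT.trans ?_)
      simpa using le_nonzero_cons y (T.map (↑))

/-- A minimal skipped interval of the maximal possible size is the whole interior of its chain, so
it is skipped because of a chain that begins with a smaller label, and no proper segment of the
chain can be skipped. -/
theorem exists_repeated_letter (hP : IsRootedForest P) {u w : Word P}
    (hrank : u.rank + 3 ≤ w.rank) {C : List (Word P)} {I : Set (Word P)}
    (hC : IsMaximalChain u w C) (hI : IsMinimalSkippedInterval u w C I)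
    (hcard : I.ncard = w.rank - u.rank - 1) :
    ∃ (a : P) (v₁ v₂ : List P),
      u.letters = v₁ ++ [a] ++ v₂ ∧ w.letters = v₁ ++ [a, a] ++ v₂ := by
  obtain ⟨vs, rfl, hd⟩ := isMaximalChain_iff.1 hC
  have hlen := hd.rank_eq hP
  have hvs : vs ≠ [] := by
    rintro rfl
    simp at hlen
    omega
  have hcard' := ncard_interior hP hd hvs
  have hfin : (openChainInterval (w :: vs) w u).Finite :=
    (List.finite_toSet (w :: vs)).subset fun v hv => hv.1
  obtain ⟨⟨⟨x, hx, y, hy, hIxy⟩, B, hB, hBC, -⟩, hmin⟩ := hI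
  have hIe : I = openChainInterval (w :: vs) w u := by
    refine Set.eq_of_subset_of_ncard_le ?_ (by omega) hfin
    rw [hIxy]
    exact fun v hv =>
      ⟨hv.1, (hd.le_of_mem hy).trans_lt hv.2.1, hv.2.2.trans_le (hd.le_of_mem_top hx)⟩
  rw [hIe] at hmin
  obtain ⟨ps, e', hr, hu⟩ := exists_run_letter hP hd
  have hM : ∀ ps₁ p ps₂ ps₃, ps = ps₁ ++ ((p :: ps₂) ++ ps₃) → (ps₁ ≠ [] ∨ ps₃ ≠ []) →
      ∃ vs₁ vs₂ vs₃ e₁ e₂, Run (fun i => (w.letter i : WithBot P)) vs₁ ps₁ e₁ ∧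
        Run e₁ vs₂ (p :: ps₂) e₂ ∧ Run e₂ vs₃ ps₃ e' ∧
        ∀ q < p, ∀ x, x ⋖ e₁ q → ¬ ofNonzero e₂ ≤ ofNonzero (Function.update e₁ q x) := by
    rintro ps₁ p ps₂ ps₃ rfl hprop
    obtain ⟨vs₁, vs', e₁, rfl, h₁, h'⟩ := hr.exists_split
    obtain ⟨vs₂, vs₃, e₂, rfl, h₂, h₃⟩ := h'.exists_split
    exact ⟨vs₁, vs₂, vs₃, e₁, e₂, h₁, h₂, h₃, fun q hq x hx =>
      not_le_update hP h₁ h₂ h₃ hu hmin hprop hq hx⟩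
  refine exists_repeated_letter_of_run hP hr hu ?_ hM ?_
  · have := hr.length_eq
    omega
  · rintro p rest rfl
    obtain ⟨vsB, rfl, hdB⟩ := isMaximalChain_iff.1 hB
    obtain ⟨qs, eB, hrB, hlt⟩ := (chainBefore_iff hP hr).1 hBC
    have hlenB := hdB.rank_eq hP
    have huB : ofNonzero eB = u := by
      obtain ⟨qs', eB', hrB', rfl⟩ := exists_run_letter hP hdB
      rw [(hrB.unique_labels hP hrB').2]
    obtain ⟨k, b, s, l', m', rfl, hkm, hbs⟩ := exists_of_lex hlt
      (by rw [← hrB.length_eq, ← hr.length_eq]; omega)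
    obtain ⟨vB₁, vB₂, eB₁, rfl, hB₁, hB₂⟩ := hrB.exists_split
    cases hB₂ with
    | cons sB hB₂ =>
      have hle := (hB₂.downTo hP).le
      rw [huB] at hle
      obtain ⟨z, hz, rfl⟩ := sB.1
      cases k with
      | nil =>
        cases hB₁
        obtain ⟨rfl, rfl⟩ := List.cons.inj hkm
        exact ⟨b, hbs, z, hz, hle⟩
      | cons a k =>
        -- chains that agree at the top share an interior element
        obtain ⟨_, _, _, e₁, e₂, h₁, -, h₃, h⟩ := hM (a :: k) s m' [] (by simpa using hkm) (by simp)
        cases h₃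
        obtain ⟨-, rfl⟩ := h₁.unique_words hP hB₁
        exact absurd (hu ▸ hle) (h b hbs z hz)

end Critical

/-! ### A repeated letter disconnects the interval -/

section Repeated

variable {P : Type*} [PartialOrder P]

theorem letterRank_eq (a : P) : letterRank a = rk (a : WithBot P) := rfl

theorem exists_lt_of_two_le_letterRank (hP : IsRootedForest P) {a : P} (ha : 2 ≤ letterRank a) :
    ∃ b : P, b < a := by
  obtain ⟨x, hx, -⟩ := exists_le_covBy hP (WithBot.bot_lt_coe a)
  have hr := rk_covBy hP hx
  rw [← letterRank_eq] at hr
  induction x with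
  | bot => rw [rk_bot] at hr; omega
  | coe b => exact ⟨b, WithBot.coe_lt_coe.1 hx.lt⟩

/-- A word between `v₁ a v₂` and `v₁ a a v₂` which fits both into a word with a decreased letter in
`v₁ a` and into a word with a decreased letter in `a v₂` is equal to `v₁ a v₂`. -/
theorem eq_of_le_decreased {v₁ v₂ : List P} {a : P} {x y z : List P}
    (hux : Word.mk (v₁ ++ a :: v₂) ≤ Word.mk x)
    (hy : Word.mk y < Word.mk (v₁ ++ [a])) (hz : Word.mk z < Word.mk (a :: v₂))
    (hxy : Word.mk x ≤ Word.mk (y ++ a :: v₂)) (hxz : Word.mk x ≤ Word.mk (v₁ ++ [a] ++ z)) :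
    x = v₁ ++ a :: v₂ := by
  obtain ⟨x₁, x₂, rfl, h₁, h₂⟩ := exists_of_le_append hxy
  obtain ⟨x₁', x₂', hx, h₁', h₂'⟩ := exists_of_le_append hxz
  have l₁ := mk_length_le (h₁.trans hy.le)
  have l₂ := mk_length_le h₂
  have l₁' := mk_length_le h₁'
  have l₂' := mk_length_le (h₂'.trans hz.le)
  simp only [List.length_append, List.length_cons, List.length_nil] at l₁ l₂ l₁' l₂'
  -- the part of `x` that fits into `a v₂` is all of `a v₂`, as the rest does not cover `v₁ a`
  have hx₂ : x₂ = a :: v₂ := by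
    obtain ⟨s₁, s₂, hs, g₁, g₂⟩ := exists_of_le_append hux
    have k₁ := mk_length_le g₁
    have k₂ := mk_length_le g₂
    rcases List.append_eq_append_iff.1 hs with ⟨r, rfl, hr⟩ | ⟨r, rfl, rfl⟩
    · cases r with
      | nil =>
        rw [List.nil_append] at hr
        rw [← hr] at g₂
        exact congrArg letters (le_antisymm h₂ g₂)
      | cons b r =>
        obtain ⟨rfl, rfl⟩ := List.cons.inj hr
        refine absurd (le_trans ?_ (g₁.trans h₁)) hy.not_ge
        simpa using mk_le_append_right (v₁ ++ [a]) r
    · rw [List.length_append, List.length_cons] at k₂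
      obtain rfl : r = [] := List.eq_nil_of_length_eq_zero (by omega)
      exact congrArg letters (le_antisymm h₂ g₂)
  -- in the same way, the part of `x` that fits into `v₁ a` is all of `v₁ a`
  have hx₁' : x₁' = v₁ ++ [a] := by
    rw [hx] at hux
    have hux' : Word.mk ((v₁ ++ [a]) ++ v₂) ≤ Word.mk (x₁' ++ x₂') := by simpa using hux
    obtain ⟨s₁, s₂, hs, g₁, g₂⟩ := exists_of_le_append hux'
    have k₁ := mk_length_le g₁
    rcases List.append_eq_append_iff.1 hs with ⟨r, rfl, hr⟩ | ⟨r, hr, rfl⟩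
    · rw [List.length_append, List.length_append] at k₁
      obtain rfl : r = [] := List.eq_nil_of_length_eq_zero (by simp at k₁; omega)
      rw [List.append_nil] at g₁
      exact congrArg letters (le_antisymm h₁' g₁)
    · rcases List.eq_nil_or_concat r with rfl | ⟨r', b, rfl⟩
      · rw [List.append_nil] at hr
        rw [← hr] at g₁
        exact congrArg letters (le_antisymm h₁' g₁)
      · rw [List.concat_eq_append, ← List.append_assoc] at hr
        obtain ⟨-, hb⟩ := List.append_inj' hr rfl
        obtain rfl := (List.cons.inj hb).1
        refine absurd (le_trans ?_ (g₂.trans h₂')) hz.not_ge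
        simpa using mk_le_append_left r' (a :: v₂)
  subst hx₂ hx₁'
  have hl := mk_length_le hux
  simp only [List.length_append, List.length_cons] at hl
  rcases List.append_eq_append_iff.1 hx with ⟨r, hr, -⟩ | ⟨r, rfl, -⟩
  · -- the part below `v₁ a` is an initial segment of `v₁ a`, of length at least that of `v₁`
    rcases List.eq_nil_or_concat r with rfl | ⟨r', b, rfl⟩
    · rw [List.append_nil] at hr
      exact absurd (hr ▸ h₁) hy.not_ge
    · rw [List.concat_eq_append, ← List.append_assoc] at hr
      obtain ⟨hr, -⟩ := List.append_inj' hr rfl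
      have hr' := congrArg List.length hr
      rw [List.length_append] at hr'
      obtain rfl : r' = [] := List.eq_nil_of_length_eq_zero (by omega)
      rw [hr, List.append_nil]
  · exact absurd ((mk_le_append_right _ r).trans h₁) hy.not_ge

/-- If `u = v₁ a v₂` and `w = v₁ a a v₂`, then no word of the open interval which lies below
`w` with a letter decreased in the first part `v₁ a` is comparable with one which does not. -/
theorem isDisconnectedInterval_of_repeated (hP : IsRootedForest P) {u w : Word P} {a : P}
    {v₁ v₂ : List P} (ha : 2 ≤ letterRank a) (hu : u.letters = v₁ ++ [a] ++ v₂)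
    (hw : w.letters = v₁ ++ [a, a] ++ v₂) : IsDisconnectedInterval u w := by
  obtain ⟨u⟩ := u
  obtain ⟨w⟩ := w
  obtain rfl : u = v₁ ++ a :: v₂ := by simpa using hu
  obtain rfl : w = (v₁ ++ [a]) ++ a :: v₂ := by simpa using hw
  clear hu hw
  obtain ⟨b, hb⟩ := exists_lt_of_two_le_letterRank hP ha
  have hlow : ∀ x y : List P, Word.mk (x ++ [b] ++ y) < Word.mk (x ++ [a] ++ y) := by
    intro x y
    refine lt_of_le_of_ne (append_le_append (append_le_append le_rfl
      (List.SublistForall₂.cons hb.le List.SublistForall₂.nil)) le_rfl) ?_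
    intro h
    simp [hb.ne] at h
  have hlen : ∀ x y : List P, x.length ≠ y.length → Word.mk x ≠ Word.mk y := by
    intro x y h h'
    exact h (congrArg (fun v : Word P => v.letters.length) h')
  rw [isDisconnectedInterval_iff]
  have hdis : ∀ x ∈ Set.Ioo (Word.mk (v₁ ++ a :: v₂)) (Word.mk ((v₁ ++ [a]) ++ a :: v₂)),
      (∃ y, Word.mk y < Word.mk (v₁ ++ [a]) ∧ x ≤ Word.mk (y ++ a :: v₂)) →
      (∃ z, Word.mk z < Word.mk (a :: v₂) ∧ x ≤ Word.mk (v₁ ++ [a] ++ z)) → False := by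
    rintro ⟨x⟩ hx ⟨y, hy, hxy⟩ ⟨z, hz, hxz⟩
    exact hx.1.ne (congrArg Word.mk (eq_of_le_decreased hx.1.le hy hz hxy hxz)).symm
  have hcov : ∀ x ∈ Set.Ioo (Word.mk (v₁ ++ a :: v₂)) (Word.mk ((v₁ ++ [a]) ++ a :: v₂)),
      (∃ y, Word.mk y < Word.mk (v₁ ++ [a]) ∧ x ≤ Word.mk (y ++ a :: v₂)) ∨
      (∃ z, Word.mk z < Word.mk (a :: v₂) ∧ x ≤ Word.mk (v₁ ++ [a] ++ z)) := by
    rintro ⟨x⟩ hx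
    obtain ⟨x₁, x₂, rfl, h₁, h₂⟩ := exists_of_le_append hx.2.le
    rcases h₁.eq_or_lt with he | hlt
    · rcases h₂.eq_or_lt with he' | hlt'
      · rw [Word.mk.inj he, Word.mk.inj he'] at hx
        exact absurd hx.2 (lt_irrefl _)
      · exact Or.inr ⟨x₂, hlt', append_le_append h₁ le_rfl⟩
    · exact Or.inl ⟨x₁, hlt, append_le_append le_rfl h₂⟩
  have hmem₁ : Word.mk (v₁ ++ [b] ++ a :: v₂) ∈
      Set.Ioo (Word.mk (v₁ ++ a :: v₂)) (Word.mk ((v₁ ++ [a]) ++ a :: v₂)) := by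
    refine ⟨lt_of_le_of_ne (append_le_append (mk_le_append_right _ _) le_rfl)
      (hlen _ _ (by simp)), hlow _ _⟩
  have hmem₂ : Word.mk (v₁ ++ [a] ++ b :: v₂) ∈
      Set.Ioo (Word.mk (v₁ ++ a :: v₂)) (Word.mk ((v₁ ++ [a]) ++ a :: v₂)) := by
    refine ⟨lt_of_le_of_ne ?_ (hlen _ _ (by simp)), by simpa using hlow (v₁ ++ [a]) v₂⟩
    have := append_le_append (le_refl (Word.mk (v₁ ++ [a]))) (mk_le_append_left [b] v₂)
    simpa using this
  refine ⟨{x | ∃ y, Word.mk y < Word.mk (v₁ ++ [a]) ∧ x ≤ Word.mk (y ++ a :: v₂)},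
    ⟨_, hmem₁, v₁ ++ [b], by simpa using hlow v₁ [], le_rfl⟩,
    ⟨_, hmem₂, fun h => hdis _ hmem₂ h ⟨b :: v₂, by simpa using hlow [] v₂, le_rfl⟩⟩, ?_⟩
  intro x hx y hy hxy
  constructor
  · intro h
    refine (hcov y hy).resolve_right fun ⟨z, hz, h'⟩ => hdis x hx h ⟨z, hz, hxy.trans h'⟩
  · rintro ⟨z, hz, h'⟩
    exact ⟨z, hz, hxy.trans h'⟩

/-- Deleting one of two equal adjacent letters, in terms of embeddings. -/
theorem repeated_iff_exists_embedding {u w : Word P} :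
    (∃ (a : P) (v₁ v₂ : List P),
      u.letters = v₁ ++ [a] ++ v₂ ∧ w.letters = v₁ ++ [a, a] ++ v₂) ↔
    ∃ η : Fin w.length → WithBot P, IsEmbedding u w η ∧
      ∃ i k : Fin w.length, (k : ℕ) + 1 = (i : ℕ) ∧ η i = ⊥ ∧ w.letter k = w.letter i ∧
        ∀ j, j ≠ i → (w.letter j : WithBot P) = η j := by
  constructor
  · rintro ⟨a, v₁, v₂, hu, hw⟩
    have hL : List.ofFn (fun i => (w.letter i : WithBot P)) =
        (v₁ ++ [a]).map (↑) ++ (a : WithBot P) :: v₂.map (↑) := by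
      rw [ofFn_letter, hw]; simp
    have hlen : w.length = v₁.length + v₂.length + 2 := by
      rw [length, hw]; simp; omega
    set i : Fin w.length := ⟨v₁.length + 1, by omega⟩ with hi
    set k : Fin w.length := ⟨v₁.length, by omega⟩ with hk
    refine ⟨Function.update (fun i => (w.letter i : WithBot P)) i ⊥, ⟨?_, update_le bot_le⟩, i, k,
      rfl, by simp, ?_, fun j hj => by rw [Function.update_of_ne hj]⟩
    · rw [ofNonzero_eq, ofFn_update_of_eq ⊥ hL (by simp [hi])]
      ext1
      simp [hu]
    · have h₁ : (w.letter i : WithBot P) = a := apply_of_ofFn hL (by simp [hi])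
      have h₂ : (w.letter k : WithBot P) = a :=
        apply_of_ofFn (L := v₁.map (↑)) (R := (a : WithBot P) :: v₂.map (↑))
          (e := fun i => (w.letter i : WithBot P)) (by rw [hL]; simp) (by simp [hk])
      exact WithBot.coe_injective (h₂.trans h₁.symm)
  · rintro ⟨η, ⟨hη, -⟩, i, k, hki, hi, hkl, hj⟩
    have hη' : η = Function.update (fun i => (w.letter i : WithBot P)) i ⊥ := by
      funext j
      by_cases h : j = i
      · subst h; simpa using hi
      · rw [Function.update_of_ne h, hj j h]
    have hi' : (k : ℕ) + 1 < w.letters.length := hki ▸ i.2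
    have hk' : (k : ℕ) < w.letters.length := k.2
    have hw : w.letters = w.letters.take k ++ [w.letter k, w.letter k] ++
        w.letters.drop (k + 1 + 1) := by
      conv_lhs => rw [← List.take_append_drop k w.letters]
      rw [← List.getElem_cons_drop hk', ← List.getElem_cons_drop hi']
      have h₁ : w.letters[(k : ℕ)] = w.letter k := rfl
      have h₂ : w.letters[(k : ℕ) + 1] = w.letter k := by
        rw [hkl]
        have : i = ⟨k + 1, hi'⟩ := Fin.ext hki.symm
        rw [this]
        rfl
      rw [h₁, h₂]
      simp
    refine ⟨w.letter k, w.letters.take k, w.letters.drop (k + 1 + 1), ?_, hw⟩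
    have hL : List.ofFn (fun i => (w.letter i : WithBot P)) =
        (w.letters.take k ++ [w.letter k]).map (↑) ++ (w.letter k : WithBot P) ::
          (w.letters.drop (k + 1 + 1)).map (↑) := by
      rw [ofFn_letter]
      conv_lhs => rw [hw]
      simp
    rw [← hη, hη', ofNonzero_eq, ofFn_update_of_eq ⊥ hL (by
      rw [List.length_map, List.length_append, List.length_take, List.length_singleton]
      omega), nonzero_append, nonzero_map_coe, nonzero_bot_cons, nonzero_map_coe]

theorem tfae (hP : IsRootedForest P) {u w : Word P} (h : u.rank + 3 ≤ w.rank) :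
    [ IsDisconnectedInterval u w,
      ∃ (a : P) (v₁ v₂ : List P),
        u.letters = v₁ ++ [a] ++ v₂ ∧ w.letters = v₁ ++ [a, a] ++ v₂,
      ∃ η : Fin w.length → WithBot P, Word.IsEmbedding u w η ∧
        ∃ i k : Fin w.length, (k : ℕ) + 1 = (i : ℕ) ∧ η i = ⊥ ∧ w.letter k = w.letter i ∧
          ∀ j, j ≠ i → (w.letter j : WithBot P) = η j,
      ∃ (C : List (Word P)) (I : Set (Word P)), Word.IsMaximalChain u w C ∧
        Word.IsMinimalSkippedInterval u w C I ∧ I.ncard = w.rank - u.rank - 1 ].TFAE := by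
  tfae_have 2 ↔ 3 := repeated_iff_exists_embedding
  tfae_have 1 → 4 := exists_isMinimalSkippedInterval hP
  tfae_have 4 → 2 := fun ⟨_, _, hC, hI, hcard⟩ => exists_repeated_letter hP h hC hI hcard
  tfae_have 2 → 1 := by
    rintro ⟨a, v₁, v₂, hu, hw⟩
    refine isDisconnectedInterval_of_repeated hP ?_ hu hw
    rw [rank, rank, hu, hw] at h
    simp only [List.map_append, List.map_cons, List.map_nil, List.sum_append, List.sum_cons,
      List.sum_nil] at h
    omega
  tfae_finish

end Repeated

end Word

namespace Permutation

/-! ### Permutations as functions on the natural numbers -/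

/-- The letter of `σ` in position `i`; it is `0` outside the range of positions. -/
def val (σ : Permutation) (i : ℕ) : ℕ := if h : i < σ.size then σ.perm ⟨i, h⟩ else 0

theorem val_eq (σ : Permutation) (i : Fin σ.size) : σ.val i = σ.perm i := by
  simp [val]

theorem val_lt (σ : Permutation) {i : ℕ} (h : i < σ.size) : σ.val i < σ.size := by
  simp [val, h]

theorem val_inj (σ : Permutation) {i j : ℕ} (hi : i < σ.size) (hj : j < σ.size)
    (h : σ.val i = σ.val j) : i = j := by
  rw [val, val, dif_pos hi, dif_pos hj] at h
  exact congrArg Fin.val (σ.perm.injective (Fin.ext h))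

theorem ext_val {σ τ : Permutation} (hs : σ.size = τ.size) (h : ∀ i < σ.size, σ.val i = τ.val i) :
    σ = τ := by
  obtain ⟨m, p⟩ := σ
  obtain ⟨n, q⟩ := τ
  obtain rfl : m = n := hs
  have : p = q := Equiv.ext fun i => Fin.ext (by simpa [val] using h i i.2)
  rw [this]

theorem exists_val_eq (n : ℕ) (v : ℕ → ℕ) (hv : ∀ i < n, v i < n)
    (hinj : ∀ i < n, ∀ j < n, v i = v j → i = j) :
    ∃ σ : Permutation, σ.size = n ∧ ∀ i < n, σ.val i = v i := by
  have hb : Function.Bijective (fun i : Fin n => (⟨v i, hv i i.2⟩ : Fin n)) :=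
    Finite.injective_iff_bijective.1 fun i j h =>
      Fin.ext (hinj i i.2 j j.2 (congrArg Fin.val h))
  refine ⟨⟨n, Equiv.ofBijective _ hb⟩, rfl, fun i hi => ?_⟩
  simp [val, hi]

theorem le_iff {σ τ : Permutation} : σ ≤ τ ↔ ∃ f : ℕ → ℕ, (∀ i < σ.size, f i < τ.size) ∧
    (∀ i j, i < j → j < σ.size → f i < f j) ∧
    ∀ i < σ.size, ∀ j < σ.size, σ.val i < σ.val j ↔ τ.val (f i) < τ.val (f j) := by
  constructor
  · rintro ⟨f, hf⟩
    refine ⟨fun i => if h : i < σ.size then f ⟨i, h⟩ else 0, fun i hi => ?_, fun i j hij hj => ?_,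
      fun i hi j hj => ?_⟩
    · simp [hi]
    · simpa [hj, hij.trans hj] using
        f.strictMono (show (⟨i, hij.trans hj⟩ : Fin _) < ⟨j, hj⟩ from hij)
    · dsimp only
      rw [dif_pos hi, dif_pos hj, val_eq, val_eq, val_eq σ ⟨i, hi⟩, val_eq σ ⟨j, hj⟩]
      exact hf ⟨i, hi⟩ ⟨j, hj⟩
  · rintro ⟨f, h₁, h₂, h₃⟩
    refine ⟨OrderEmbedding.ofStrictMono (fun i => ⟨f i, h₁ i i.2⟩) fun i j hij => h₂ i j hij j.2,
      fun i j => ?_⟩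
    have := h₃ i i.2 j j.2
    rw [val_eq, val_eq] at this
    rw [val, val, dif_pos (h₁ i i.2), dif_pos (h₁ j j.2)] at this
    exact this

@[simp] theorem size_directSum (σ τ : Permutation) :
    (σ.directSum τ).size = σ.size + τ.size := rfl

theorem val_directSum_left (σ τ : Permutation) {i : ℕ} (hi : i < σ.size) :
    (σ.directSum τ).val i = σ.val i := by
  have h := val_eq (σ.directSum τ) (Fin.castAdd τ.size ⟨i, hi⟩)
  have h' := val_eq σ ⟨i, hi⟩
  refine h.trans (Eq.trans ?_ h'.symm)
  change ((finSumFinEquiv.permCongr (Equiv.Perm.sumCongr σ.perm τ.perm))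
    (Fin.castAdd τ.size ⟨i, hi⟩) : ℕ) = _
  rw [Equiv.permCongr_apply, finSumFinEquiv_symm_apply_castAdd, Equiv.Perm.sumCongr_apply,
    Sum.map_inl, finSumFinEquiv_apply_left, Fin.val_castAdd]

theorem val_directSum_right (σ τ : Permutation) {j : ℕ} (hj : j < τ.size) :
    (σ.directSum τ).val (σ.size + j) = σ.size + τ.val j := by
  have h := val_eq (σ.directSum τ) (Fin.natAdd σ.size ⟨j, hj⟩)
  have h' := val_eq τ ⟨j, hj⟩
  refine h.trans (Eq.trans ?_ (congrArg (σ.size + ·) h').symm)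
  change ((finSumFinEquiv.permCongr (Equiv.Perm.sumCongr σ.perm τ.perm))
    (Fin.natAdd σ.size ⟨j, hj⟩) : ℕ) = _
  rw [Equiv.permCongr_apply, finSumFinEquiv_symm_apply_natAdd, Equiv.Perm.sumCongr_apply,
    Sum.map_inr, finSumFinEquiv_apply_right, Fin.val_natAdd]

theorem empty_le (τ : Permutation) : empty ≤ τ :=
  le_iff.2 ⟨id, fun i hi => absurd hi (Nat.not_lt_zero i),
    fun _ j _ hj => absurd hj (Nat.not_lt_zero j), fun i hi => absurd hi (Nat.not_lt_zero i)⟩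

theorem size_le_of_le {σ τ : Permutation} (h : σ ≤ τ) : σ.size ≤ τ.size := by
  obtain ⟨f, -⟩ := h
  simpa using Fintype.card_le_of_injective f f.injective

theorem directSum_mono {σ σ' τ τ' : Permutation} (h : σ ≤ σ') (h' : τ ≤ τ') :
    σ.directSum τ ≤ σ'.directSum τ' := by
  obtain ⟨f, f₁, f₂, f₃⟩ := le_iff.1 h
  obtain ⟨g, g₁, g₂, g₃⟩ := le_iff.1 h'
  refine le_iff.2 ⟨fun i => if i < σ.size then f i else σ'.size + g (i - σ.size), ?_, ?_, ?_⟩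
  · intro i hi
    rw [size_directSum] at hi ⊢
    dsimp only
    split_ifs with h
    · have := f₁ i h
      omega
    · have := g₁ (i - σ.size) (by omega)
      omega
  · intro i j hij hj
    rw [size_directSum] at hj
    dsimp only
    split_ifs with hi' hj' hj'
    · exact f₂ i j hij hj'
    · have := f₁ i hi'
      omega
    · omega
    · have := g₂ (i - σ.size) (j - σ.size) (by omega) (by omega)
      omega
  · have left : ∀ i, i < σ.size → (σ.directSum τ).val i = σ.val i ∧
        (σ'.directSum τ').val (f i) = σ'.val (f i) ∧ σ.val i < σ.size ∧ σ'.val (f i) < σ'.size :=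
      fun i hi => ⟨val_directSum_left _ _ hi, val_directSum_left _ _ (f₁ i hi), val_lt _ hi,
        val_lt _ (f₁ i hi)⟩
    have right : ∀ i, ¬ i < σ.size → i < σ.size + τ.size →
        (σ.directSum τ).val i = σ.size + τ.val (i - σ.size) ∧
        (σ'.directSum τ').val (σ'.size + g (i - σ.size)) =
          σ'.size + τ'.val (g (i - σ.size)) := by
      intro i hi hi'
      have h := val_directSum_right σ τ (j := i - σ.size) (by omega)
      rw [Nat.add_sub_cancel' (not_lt.1 hi)] at h
      exact ⟨h, val_directSum_right σ' τ' (g₁ _ (by omega))⟩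
    intro i hi j hj
    rw [size_directSum] at hi hj
    dsimp only
    split_ifs with hi' hj' hj'
    · rw [(left i hi').1, (left j hj').1, (left i hi').2.1, (left j hj').2.1]
      exact f₃ i hi' j hj'
    · have a := left i hi'
      have b := right j hj' hj
      omega
    · have a := right i hi' hi
      have b := left j hj'
      omega
    · rw [(right i hi' hi).1, (right i hi' hi).2, (right j hj' hj).1, (right j hj' hj).2,
        Nat.add_lt_add_iff_left, Nat.add_lt_add_iff_left]
      exact g₃ _ (by omega) _ (by omega)

theorem empty_directSum (τ : Permutation) : empty.directSum τ = τ := by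
  refine ext_val (Nat.zero_add _) fun i hi => ?_
  have hi' : i < τ.size := by simpa [empty] using hi
  have := val_directSum_right empty τ hi'
  simpa [empty] using this

theorem le_directSum_right (σ τ : Permutation) : τ ≤ σ.directSum τ := by
  conv_lhs => rw [← empty_directSum τ]
  exact directSum_mono (empty_le σ) le_rfl

theorem directSum_left_cancel {α σ τ : Permutation} (h : α.directSum σ = α.directSum τ) :
    σ = τ := by
  have hs : α.size + σ.size = α.size + τ.size := congrArg size h
  refine ext_val (by omega) fun i hi => ?_
  have h₁ := val_directSum_right α σ hi
  have h₂ := val_directSum_right α τ (j := i) (by omega)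
  rw [h] at h₁
  omega

/-- A pattern of a direct sum is the direct sum of a pattern of each summand: the positions of the
pattern which lie in the first summand form an initial segment, and so do their values. -/
theorem exists_directSum_of_le {π α β : Permutation} (h : π ≤ α.directSum β) :
    ∃ α' β', α' ≤ α ∧ β' ≤ β ∧ π = directSum α' β' := by
  classical
  obtain ⟨f, f₁, f₂, f₃⟩ := le_iff.1 h
  rw [size_directSum] at f₁
  -- the first position `k` of the pattern that lies in the second summand
  obtain ⟨k, hkn, hk⟩ : ∃ k ≤ π.size, ∀ i < π.size, i < k ↔ f i < α.size := by
    have hex : ∃ k, k = π.size ∨ (k < π.size ∧ α.size ≤ f k) := ⟨_, Or.inl rfl⟩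
    refine ⟨Nat.find hex, Nat.find_min' hex (Or.inl rfl), fun i hi => ⟨fun h => ?_, fun h => ?_⟩⟩
    · have := Nat.find_min hex h
      push Not at this
      exact this.2 hi
    · by_contra hle
      rcases Nat.find_spec hex with hs | ⟨hs, hs'⟩
      · omega
      · rcases (not_lt.1 hle).eq_or_lt with he | hlt
        · rw [he] at hs'
          omega
        · have := f₂ _ _ hlt hi
          omega
  have left : ∀ i, i < k → (α.directSum β).val (f i) = α.val (f i) ∧ α.val (f i) < α.size :=
    fun i hi => have := (hk i (by omega)).1 hi
      ⟨val_directSum_left _ _ this, val_lt _ this⟩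
  have right : ∀ i, k ≤ i → i < π.size → α.size ≤ f i ∧ f i - α.size < β.size ∧
      (α.directSum β).val (f i) = α.size + β.val (f i - α.size) := by
    intro i hi hi'
    have h₁ := hk i hi'
    have h₂ := f₁ i hi'
    have h₃ := val_directSum_right α β (j := f i - α.size) (by omega)
    rw [Nat.add_sub_cancel' (by omega)] at h₃
    exact ⟨by omega, by omega, h₃⟩
  have hlt : ∀ i j, i < k → k ≤ j → j < π.size → π.val i < π.val j := by
    intro i j hi hj hj'
    rw [f₃ i (by omega) j hj', (left i hi).1, (right j hj hj').2.2]
    have := (left i hi).2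
    omega
  have hsmall : ∀ i < k, π.val i < k := by
    intro i hi
    have hcard := Finset.card_le_card_of_injOn (s := Finset.Ico k π.size)
      (t := Finset.Ioo (π.val i) π.size) π.val (by
        intro j hj
        rw [Finset.coe_Ico, Set.mem_Ico] at hj
        rw [Finset.coe_Ioo]
        exact ⟨hlt i j hi hj.1 hj.2, val_lt _ hj.2⟩) (by
        intro a ha b hb
        rw [Finset.coe_Ico, Set.mem_Ico] at ha hb
        exact val_inj π ha.2 hb.2)
    rw [Nat.card_Ico, Nat.card_Ioo] at hcard
    have := val_lt π (i := i) (by omega)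
    omega
  have hlarge : ∀ j, k ≤ j → j < π.size → k ≤ π.val j := by
    intro j hj hj'
    have hcard := Finset.card_le_card_of_injOn (s := Finset.range k)
      (t := Finset.range (π.val j)) π.val (by
        intro i hi
        rw [Finset.coe_range, Set.mem_Iio] at hi
        rw [Finset.coe_range]
        exact hlt i j hi hj hj') (by
        intro a ha b hb
        rw [Finset.coe_range, Set.mem_Iio] at ha hb
        exact val_inj π (by omega) (by omega))
    simpa using hcard
  obtain ⟨α', hα, hα'⟩ := exists_val_eq k π.val hsmall
    fun i hi j hj h => val_inj π (by omega) (by omega) h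
  obtain ⟨β', hβ, hβ'⟩ := exists_val_eq (π.size - k) (fun j => π.val (k + j) - k)
    (fun j hj => by
      have := val_lt π (i := k + j) (by omega)
      omega)
    (fun i hi j hj h => by
      have h₁ := hlarge (k + i) (by omega) (by omega)
      have h₂ := hlarge (k + j) (by omega) (by omega)
      have := val_inj π (i := k + i) (j := k + j) (by omega) (by omega) (by omega)
      omega)
  refine ⟨α', β', le_iff.2 ⟨f, ?_, ?_, ?_⟩,
    le_iff.2 ⟨fun j => f (k + j) - α.size, ?_, ?_, ?_⟩, ext_val ?_ ?_⟩
  · exact fun i hi => (hk i (by omega)).1 (by omega)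
  · exact fun i j hij hj => f₂ i j hij (by omega)
  · intro i hi j hj
    rw [hα' i (by omega), hα' j (by omega), f₃ i (by omega) j (by omega), (left i (by omega)).1,
      (left j (by omega)).1]
  · exact fun j hj => (right (k + j) (by omega) (by omega)).2.1
  · intro i j hij hj
    have h₁ := right (k + i) (by omega) (by omega)
    have h₂ := f₂ (k + i) (k + j) (by omega) (by omega)
    dsimp only
    omega
  · intro i hi j hj
    have h₁ := (right (k + i) (by omega) (by omega)).2.2
    have h₂ := (right (k + j) (by omega) (by omega)).2.2
    have h₃ := f₃ (k + i) (by omega) (k + j) (by omega)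
    have h₄ := hlarge (k + i) (by omega) (by omega)
    have h₅ := hlarge (k + j) (by omega) (by omega)
    rw [hβ' i (by omega), hβ' j (by omega)]
    dsimp only
    omega
  · rw [size_directSum]; omega
  · intro i hi
    by_cases hik : i < k
    · rw [val_directSum_left _ _ (by omega), hα' i hik]
    · have h₁ := val_directSum_right α' β' (j := i - k) (by omega)
      have h₂ := hlarge i (by omega) hi
      rw [hβ' _ (by omega), hα, Nat.add_sub_cancel' (not_lt.1 hik)] at h₁
      omega

/-! ### Layered permutations and compositions -/

/-- The decreasing permutation of length `n`. -/
def decreasing (n : ℕ) : Permutation := ⟨n, Fin.revPerm⟩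

theorem val_decreasing {n i : ℕ} (hi : i < n) : (decreasing n).val i = n - (i + 1) := by
  rw [val, dif_pos (show i < (decreasing n).size from hi)]
  exact Fin.val_rev (⟨i, hi⟩ : Fin n)

theorem eq_decreasing {π : Permutation} (h : StrictAnti π.perm) : π = decreasing π.size := by
  obtain ⟨n, p⟩ := π
  have hmono : StrictMono (fun i => p (Fin.rev i)) := fun i j hij => h (Fin.rev_lt_rev.2 hij)
  have hid : ∀ i, p (Fin.rev i) = i := fun i => by
    have hs : Function.Surjective (fun i => p (Fin.rev i)) :=
      Finite.surjective_of_injective hmono.injective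
    have h := Subsingleton.elim (StrictMono.orderIsoOfSurjective _ hmono hs)
      (OrderIso.refl (Fin n))
    exact DFunLike.congr_fun h i
  have : p = Fin.revPerm := Equiv.ext fun i => by simpa using hid (Fin.rev i)
  rw [this]
  rfl

theorem decreasing_mono {m n : ℕ} (h : m ≤ n) : decreasing m ≤ decreasing n := by
  refine le_iff.2 ⟨id, fun i hi => lt_of_lt_of_le hi h, fun i j hij _ => hij, fun i hi j hj => ?_⟩
  have hi' : i < m := hi
  have hj' : j < m := hj
  rw [val_decreasing hi', val_decreasing hj', id, id, val_decreasing (hi'.trans_le h),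
    val_decreasing (hj'.trans_le h)]
  omega

theorem eq_decreasing_of_le {π : Permutation} {n : ℕ} (h : π ≤ decreasing n) :
    π = decreasing π.size := by
  obtain ⟨f, hf⟩ := h
  exact eq_decreasing fun i j hij => (hf j i).2 (Fin.rev_lt_rev.2 (f.strictMono hij))

/-- The layered permutation with a given composition. -/
def layered (c : List ℕ+) : Permutation :=
  (c.map fun a : ℕ+ => decreasing (a : ℕ)).foldr directSum empty

theorem layered_cons (a : ℕ+) (c : List ℕ+) :
    layered (a :: c) = (decreasing a).directSum (layered c) := rfl

theorem layered_mono {c d : List ℕ+} (h : Word.mk c ≤ Word.mk d) : layered c ≤ layered d := by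
  have h' : List.SublistForall₂ (· ≤ ·) c d := h
  clear h
  induction h' with
  | nil => exact empty_le _
  | cons hab _ ih => exact directSum_mono (decreasing_mono hab) ih
  | cons_right _ ih => exact ih.trans (le_directSum_right _ _)

theorem exists_layered_of_le {π : Permutation} {d : List ℕ+} (h : π ≤ layered d) :
    ∃ c, Word.mk c ≤ Word.mk d ∧ π = layered c := by
  induction d generalizing π with
  | nil => exact ⟨[], le_rfl, le_antisymm h (empty_le π)⟩
  | cons a d ih =>
    obtain ⟨α, β, hα, hβ, rfl⟩ := exists_directSum_of_le h
    obtain ⟨c, hc, rfl⟩ := ih hβ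
    have hs : α.size ≤ a := size_le_of_le hα
    rcases Nat.eq_zero_or_pos α.size with h0 | hpos
    · refine ⟨c, List.SublistForall₂.cons_right hc, ?_⟩
      have : α = empty := ext_val h0 fun i hi => absurd hi (by omega)
      rw [this, empty_directSum]
    · obtain ⟨m, hm⟩ : ∃ m : ℕ+, (m : ℕ) = α.size := ⟨⟨α.size, hpos⟩, rfl⟩
      refine ⟨m :: c, List.SublistForall₂.cons (PNat.coe_le_coe m a |>.1 (hm ▸ hs)) hc, ?_⟩
      rw [layered_cons, hm, ← eq_decreasing_of_le hα]

/-- The first layer can be read off from the first letter of the permutation. -/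
theorem layered_injective : Function.Injective layered := by
  intro c
  induction c with
  | nil =>
    intro d h
    cases d with
    | nil => rfl
    | cons b d =>
      have hs : 0 = (b : ℕ) + (layered d).size := congrArg size h
      have := b.pos
      omega
  | cons a c ih =>
    intro d h
    cases d with
    | nil =>
      have hs : (a : ℕ) + (layered c).size = 0 := congrArg size h
      have := a.pos
      omega
    | cons b d =>
      have h₁ := congrArg (fun σ => val σ 0) h
      simp only [layered_cons] at h₁
      rw [val_directSum_left _ _ a.pos, val_directSum_left _ _ b.pos, val_decreasing a.pos,
        val_decreasing b.pos] at h₁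
      have ha := a.pos
      have hb := b.pos
      obtain rfl : a = b := PNat.coe_injective (by omega)
      rw [ih (directSum_left_cancel h)]

/-- The layered permutations form a lower set of the pattern order, isomorphic to the generalized
subword order on words of positive integers. -/
def layeredEmbedding : Word ℕ+ ↪o Permutation :=
  OrderEmbedding.ofMapLEIff (fun w => layered w.letters) fun u w =>
    ⟨fun h => by
      obtain ⟨c, hc, he⟩ := exists_layered_of_le h
      rw [← layered_injective he] at hc
      exact hc, fun h => layered_mono h⟩

theorem isLowerSet_range_layeredEmbedding : IsLowerSet (Set.range layeredEmbedding) := by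
  rintro _ π hπ ⟨w, rfl⟩
  obtain ⟨c, -, rfl⟩ := exists_layered_of_le hπ
  exact ⟨⟨c⟩, rfl⟩

theorem isRootedForest_pnat : IsRootedForest ℕ+ :=
  ⟨fun a => Set.finite_Iic a, fun _ _ _ _ _ _ => le_total _ _⟩

theorem letterRank_pnat (a : ℕ+) : Word.letterRank a = a := by
  rw [Word.letterRank_eq]
  induction a using PNat.recOn with
  | one =>
    rw [Word.rk_covBy isRootedForest_pnat (x := ⊥) (WithBot.bot_covBy_coe.2 fun b _ => one_le),
      Word.rk_bot]
    rfl
  | succ a ih =>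
    rw [Word.rk_covBy isRootedForest_pnat (x := (a : WithBot ℕ+))
      (WithBot.coe_covBy_coe.2 (Order.covBy_add_one a)), ih]
    rfl

theorem size_layered (c : List ℕ+) : (layered c).size = (Word.mk c).rank := by
  induction c with
  | nil => rfl
  | cons a c ih =>
    rw [layered_cons, size_directSum, ih, Word.rank, Word.rank, List.map_cons, List.sum_cons,
      letterRank_pnat]
    rfl

theorem IsLayeredWith.exists_eq_layered {σ : Permutation} {c : List ℕ} (h : σ.IsLayeredWith c) :
    ∃ c' : List ℕ+, c = c'.map (↑) ∧ σ = layered c' := by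
  obtain ⟨L, ⟨rfl, hind⟩, hanti, rfl⟩ := h
  induction L with
  | nil => exact ⟨[], rfl, rfl⟩
  | cons π L ih =>
    obtain ⟨c', hc, hσ⟩ := ih (fun π hπ => hind π (List.mem_cons_of_mem _ hπ))
      (fun π hπ => hanti π (List.mem_cons_of_mem _ hπ))
    obtain ⟨m, hm⟩ : ∃ m : ℕ+, (m : ℕ) = π.size :=
      ⟨⟨π.size, (hind π List.mem_cons_self).1⟩, rfl⟩
    refine ⟨m :: c', by simp [hc, hm], ?_⟩
    rw [layered_cons, ← hσ, List.foldr_cons, hm, ← eq_decreasing (hanti π List.mem_cons_self)]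

theorem isDisconnectedInterval_iff_composition {σ τ : Permutation} {c d : List ℕ}
    (hσ : σ.IsLayeredWith c) (hτ : τ.IsLayeredWith d) (h : σ.size + 3 ≤ τ.size) :
    IsDisconnectedInterval σ τ ↔ ∃ (a : ℕ) (v₁ v₂ : List ℕ), 3 ≤ a ∧
      c = v₁ ++ [a] ++ v₂ ∧ d = v₁ ++ [a, a] ++ v₂ := by
  obtain ⟨c, rfl, rfl⟩ := hσ.exists_eq_layered
  obtain ⟨d, rfl, rfl⟩ := hτ.exists_eq_layered
  rw [size_layered, size_layered] at h
  have key : IsDisconnectedInterval (layered c) (layered d) ↔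
      IsDisconnectedInterval (Word.mk c) (Word.mk d) :=
    isDisconnectedInterval_map_iff layeredEmbedding isLowerSet_range_layeredEmbedding
  have repeated : IsDisconnectedInterval (Word.mk c) (Word.mk d) ↔
      ∃ (a : ℕ+) (v₁ v₂ : List ℕ+), c = v₁ ++ [a] ++ v₂ ∧ d = v₁ ++ [a, a] ++ v₂ :=
    (Word.tfae isRootedForest_pnat h).out 0 1
  rw [key, repeated]
  constructor
  · rintro ⟨a, v₁, v₂, rfl, rfl⟩
    refine ⟨a, v₁.map (↑), v₂.map (↑), ?_, by simp, by simp⟩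
    -- the difference of the ranks is the size of the deleted layer
    simp only [Word.rank, List.map_append, List.map_cons, List.map_nil, List.sum_append,
      List.sum_cons, List.sum_nil, letterRank_pnat] at h
    omega
  · rintro ⟨a, v₁, v₂, -, hc, hd⟩
    obtain ⟨c', v₂', rfl, hc', rfl⟩ := List.map_eq_append_iff.1 hc
    obtain ⟨v₁', a', rfl, rfl, ha⟩ := List.map_eq_append_iff.1 hc'
    obtain ⟨a', rfl, rfl⟩ := List.map_eq_singleton_iff.1 ha
    refine ⟨a', v₁', v₂', rfl, List.map_injective_iff.2 PNat.coe_injective ?_⟩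
    rw [hd]
    simp

end Permutation

theorem mainTheorem2 :
    (∀ (P : Type*) [PartialOrder P], IsRootedForest P →
      ∀ u w : Word P, u.rank + 3 ≤ w.rank →
        [ IsDisconnectedInterval u w,
          ∃ (a : P) (v₁ v₂ : List P),
            u.letters = v₁ ++ [a] ++ v₂ ∧ w.letters = v₁ ++ [a, a] ++ v₂,
          ∃ η : Fin w.length → WithBot P, Word.IsEmbedding u w η ∧
            ∃ i k : Fin w.length, (k : ℕ) + 1 = (i : ℕ) ∧ η i = ⊥ ∧ w.letter k = w.letter i ∧
              ∀ j, j ≠ i → (w.letter j : WithBot P) = η j,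
          ∃ (C : List (Word P)) (I : Set (Word P)), Word.IsMaximalChain u w C ∧
            Word.IsMinimalSkippedInterval u w C I ∧ I.ncard = w.rank - u.rank - 1 ].TFAE) ∧
    (∀ (σ τ : Permutation) (c d : List ℕ), σ.IsLayeredWith c → τ.IsLayeredWith d →
      σ.size + 3 ≤ τ.size →
        (IsDisconnectedInterval σ τ ↔
          ∃ (a : ℕ) (v₁ v₂ : List ℕ), 3 ≤ a ∧
            c = v₁ ++ [a] ++ v₂ ∧ d = v₁ ++ [a, a] ++ v₂)) :=
  ⟨fun _ _ hP _ _ h => Word.tfae hP h,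
    fun _ _ _ _ hσ hτ h => Permutation.isDisconnectedInterval_iff_composition hσ hτ h⟩
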